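/- Let $K$ be an algebraically closed field of characteristic zero, let $r\geq 1$, and let $\mathbb{P}^N$ be the projective space of symmetric $2r\times 2r$ matrices over $K$ modulo scalars, with the Zariski topology. Let $$Sp(2r)=\{M\in M_{2r,2r}(K) \mid M^t\Omega M=\Omega\},\qquad \Omega=\begin{pmatrix}0&I_{r,r}\\-I_{r,r}&0\end{pmatrix},$$ act on $\mathbb{P}^N$ by $(M,Z)\mapsto MZM^t$. For $1\leq k\leq 2r$ let $I_k$ be the diagonal $2r\times 2r$ matrix whose first $k$ diagonal entries are $1$ and whose other entries are $0$, and let $Y_k\subset\mathbb{P}^N$ be the Zariski closure of the $Sp(2r)$-orbit of $I_k$. Let $X_{2r}\subset\mathbb{P}^N$ be the Zariski closure of the $Sp(2r)$-orbit of the identity matrix. If $1\leq k\leq r$, then $$\dim(Y_k)=r(2r+1)-\frac{k(k-1)}{2}-r(r-k)-\frac{r(r+1)}{2}-\frac{(r-k)(r-k+1)}{2}-1=2rk+k-k^2-1.$$ Moreover $\dim(Y_{2r})=r(r+1)$. The projective variety $X_{2r}$ is irreducible and $\dim(X_{2r})=r(r+1)$. -/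

import Mathlib

open scoped LinearAlgebra.Projectivization Matrix

namespace SymplecticQuadrics

/-- The `K`-vector space of symmetric `2r × 2r` matrices, with rows and columns indexed by
`Fin r ⊕ Fin r` (first block of `r` indices, then second block of `r` indices). -/
def SymMat (K : Type*) [Field K] (r : ℕ) :
    Submodule K (Matrix (Fin r ⊕ Fin r) (Fin r ⊕ Fin r) K) where
  carrier := {Z | Z.IsSymm}
  add_mem' := fun ha hb => ha.add hb
  zero_mem' := Matrix.isSymm_zero
  smul_mem' := fun c _ h => h.smul c

/-- The projective space `ℙ^N` of symmetric `2r × 2r` matrices modulo scalars. -/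
abbrev PSym (K : Type*) [Field K] (r : ℕ) : Type _ := ℙ K (SymMat K r)

/-! ### The Zariski topology on the projective space of symmetric matrices -/

/-- Polynomials in the entries `z_{i,j}` of a matrix. On symmetric matrices `z_{i,j}` and `z_{j,i}`
are the same function, so the (homogeneous) polynomials in all the entries induce exactly
the (homogeneous) polynomial functions in the coordinates `z_{i,j}`, `i ≤ j`. -/
abbrev EntryPoly (K : Type*) [Field K] (r : ℕ) : Type _ :=
  MvPolynomial ((Fin r ⊕ Fin r) × (Fin r ⊕ Fin r)) K

/-- The value of a polynomial at the entries of a symmetric matrix. -/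
noncomputable def evalAt {K : Type*} [Field K] {r : ℕ} (Z : SymMat K r) (p : EntryPoly K r) : K :=
  MvPolynomial.eval (fun ij => (Z : Matrix (Fin r ⊕ Fin r) (Fin r ⊕ Fin r) K) ij.1 ij.2) p

/-- The common zero locus in `ℙ^N` of a set of polynomials (used for homogeneous ones, for which
the choice of a representative does not matter, see `mk_mem_projZeros`). -/
def projZeros {K : Type*} [Field K] {r : ℕ} (S : Set (EntryPoly K r)) : Set (PSym K r) :=
  {x | ∀ p ∈ S, evalAt x.rep p = 0}

/-- A subset of `ℙ^N` is algebraic if it is the common zero locus of a set of homogeneous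
polynomials (possibly of different degrees). -/
def IsAlgebraic {K : Type*} [Field K] {r : ℕ} (T : Set (PSym K r)) : Prop :=
  ∃ S : Set (EntryPoly K r), (∀ p ∈ S, ∃ d : ℕ, p.IsHomogeneous d) ∧ T = projZeros S

theorem evalAt_smul {K : Type*} [Field K] {r : ℕ} (c : K) (Z : SymMat K r) {p : EntryPoly K r}
    {d : ℕ} (hp : p.IsHomogeneous d) : evalAt (c • Z) p = c ^ d * evalAt Z p := by
  simp only [evalAt, MvPolynomial.eval_eq, Finset.mul_sum]
  refine Finset.sum_congr rfl fun m hm => ?_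
  have hdeg : ∑ i ∈ m.support, m i = d := by
    rw [← hp (MvPolynomial.mem_support_iff.1 hm), Finsupp.weight_apply]
    simp [Finsupp.sum]
  simp only [Submodule.coe_smul, Matrix.smul_apply, smul_eq_mul, mul_pow,
    Finset.prod_mul_distrib, Finset.prod_pow_eq_pow_sum, hdeg]
  ring

theorem mk_mem_projZeros {K : Type*} [Field K] {r : ℕ} {S : Set (EntryPoly K r)}
    (hS : ∀ p ∈ S, ∃ d : ℕ, p.IsHomogeneous d) (Z : SymMat K r) (hZ : Z ≠ 0) :
    Projectivization.mk K Z hZ ∈ projZeros S ↔ ∀ p ∈ S, evalAt Z p = 0 := by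
  obtain ⟨a, ha⟩ := Projectivization.exists_smul_eq_mk_rep K Z hZ
  refine forall₂_congr fun p hp => ?_
  obtain ⟨d, hd⟩ := hS p hp
  rw [← ha, Units.smul_def, evalAt_smul _ _ hd]
  simp

/-- The Zariski topology on `ℙ^N`: the closed subsets are the algebraic ones. -/
instance zariskiTopology (K : Type*) [Field K] (r : ℕ) : TopologicalSpace (PSym K r) :=
  TopologicalSpace.ofClosed {T | IsAlgebraic T}
    ⟨{1}, fun p hp => ⟨0, by
        rw [Set.mem_singleton_iff.1 hp]; exact MvPolynomial.isHomogeneous_one _ _⟩, by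
      ext x; simp [projZeros, evalAt]⟩
    (by
      intro A hA
      have hA' : ∀ T ∈ A, IsAlgebraic T := fun T hT => hA hT
      choose! S hS hT using hA'
      refine ⟨⋃ T ∈ A, S T, ?_, ?_⟩
      · intro p hp
        simp only [Set.mem_iUnion] at hp
        obtain ⟨T, hTA, hpT⟩ := hp
        exact hS T hTA p hpT
      · ext x
        simp only [Set.mem_sInter, projZeros, Set.mem_ofPred_eq, Set.mem_iUnion]
        constructor
        · rintro h p ⟨T, hTA, hpT⟩
          have := h T hTA
          rw [hT T hTA] at this
          exact this p hpT
        · intro h T hTA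
          rw [hT T hTA]
          exact fun p hp => h p ⟨T, hTA, hp⟩)
    (by
      rintro _ ⟨S, hS, rfl⟩ _ ⟨S', hS', rfl⟩
      refine ⟨{q | ∃ p ∈ S, ∃ p' ∈ S', q = p * p'}, ?_, ?_⟩
      · rintro _ ⟨p, hp, p', hp', rfl⟩
        obtain ⟨d, hd⟩ := hS p hp
        obtain ⟨d', hd'⟩ := hS' p' hp'
        exact ⟨d + d', hd.mul hd'⟩
      · ext x
        constructor
        · rintro (h | h) _ ⟨p, hp, p', hp', rfl⟩
          · have := h p hp
            simp_all [evalAt]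
          · have := h p' hp'
            simp_all [evalAt]
        · intro h
          by_contra hx
          rw [Set.mem_union, not_or] at hx
          simp only [projZeros, Set.mem_ofPred_eq, not_forall] at hx
          obtain ⟨⟨p, hp, hpx⟩, p', hp', hpx'⟩ := hx
          have := h _ ⟨p, hp, p', hp', rfl⟩
          simp_all [evalAt])

theorem isClosed_iff_isAlgebraic {K : Type*} [Field K] {r : ℕ} (T : Set (PSym K r)) :
    IsClosed T ↔ IsAlgebraic T :=
  by
  rw [← isOpen_compl_iff]
  change IsAlgebraic Tᶜᶜ ↔ _
  rw [compl_compl]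

/-! ### The action of the symplectic group -/

/-- The linear action `(M, Z) ↦ M Z Mᵗ` of `Sp(2r)` on symmetric matrices. It induces an action of
`Sp(2r)` on `ℙ^N` by `M • [Z] = [M Z Mᵗ]`. -/
instance symplecticAction (K : Type*) [Field K] (r : ℕ) :
    DistribMulAction (Matrix.symplecticGroup (Fin r) K) (SymMat K r) where
  smul M Z := ⟨M.1 * Z.1 * M.1ᵀ, by
    have hZ : Z.1ᵀ = Z.1 := Z.2
    change (M.1 * Z.1 * M.1ᵀ)ᵀ = _
    simp [Matrix.transpose_mul, hZ, Matrix.mul_assoc]⟩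
  one_smul Z := Subtype.ext (by
    change (1 : Matrix _ _ K) * Z.1 * (1 : Matrix _ _ K)ᵀ = Z.1
    simp)
  mul_smul M M' Z := Subtype.ext (by
    change (M.1 * M'.1) * Z.1 * (M.1 * M'.1)ᵀ = M.1 * (M'.1 * Z.1 * M'.1ᵀ) * M.1ᵀ
    simp [Matrix.transpose_mul, Matrix.mul_assoc])
  smul_zero M := Subtype.ext (by
    change M.1 * (0 : Matrix _ _ K) * M.1ᵀ = 0
    simp)
  smul_add M Z Z' := Subtype.ext (by
    change M.1 * (Z.1 + Z'.1) * M.1ᵀ = M.1 * Z.1 * M.1ᵀ + M.1 * Z'.1 * M.1ᵀ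
    simp [Matrix.mul_add, Matrix.add_mul])

instance symplecticAction_comm (K : Type*) [Field K] (r : ℕ) :
    SMulCommClass (Matrix.symplecticGroup (Fin r) K) K (SymMat K r) where
  smul_comm M c Z := Subtype.ext (by
    change M.1 * (c • Z.1) * M.1ᵀ = c • (M.1 * Z.1 * M.1ᵀ)
    simp)

/-! ### The orbit closures -/

/-- The matrix `I_k`: diagonal, with `1` in the first `k` diagonal places and `0` elsewhere. -/
def partialId (K : Type*) [Field K] (r k : ℕ) : SymMat K r :=
  ⟨Matrix.diagonal fun i => if (finSumFinEquiv i : ℕ) < k then 1 else 0,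
    Matrix.isSymm_diagonal _⟩

/-- The identity matrix, as a symmetric matrix. -/
def idMat (K : Type*) [Field K] (r : ℕ) : SymMat K r := ⟨1, Matrix.isSymm_one⟩

theorem partialId_ne_zero (K : Type*) [Field K] {r k : ℕ} (hr : 1 ≤ r) (hk : 1 ≤ k) :
    partialId K r k ≠ 0 := by
  intro h
  have h1 := congrFun (congrFun (congrArg Subtype.val h) (Sum.inl ⟨0, hr⟩)) (Sum.inl ⟨0, hr⟩)
  simp [partialId, Nat.pos_iff_ne_zero.1 hk, Nat.pos_iff_ne_zero] at h1

theorem idMat_ne_zero (K : Type*) [Field K] {r : ℕ} (hr : 1 ≤ r) : idMat K r ≠ 0 := by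
  intro h
  have h1 := congrFun (congrFun (congrArg Subtype.val h) (Sum.inl ⟨0, hr⟩)) (Sum.inl ⟨0, hr⟩)
  simp [idMat] at h1

/-- `Y_k`: the Zariski closure in `ℙ^N` of the `Sp(2r)`-orbit of `I_k`. -/
def Y (K : Type*) [Field K] (r k : ℕ) (hr : 1 ≤ r) (hk : 1 ≤ k) : Set (PSym K r) :=
  closure (MulAction.orbit (Matrix.symplecticGroup (Fin r) K)
    (Projectivization.mk K (partialId K r k) (partialId_ne_zero K hr hk)))

/-- `X_{2r}`: the Zariski closure in `ℙ^N` of the `Sp(2r)`-orbit of the identity. -/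
def X (K : Type*) [Field K] (r : ℕ) (hr : 1 ≤ r) : Set (PSym K r) :=
  closure (MulAction.orbit (Matrix.symplecticGroup (Fin r) K)
    (Projectivization.mk K (idMat K r) (idMat_ne_zero K hr)))

end SymplecticQuadrics

/-!
Both families of orbit closures are handled through an explicit open cell of the orbit that is
rational: an open subset of an affine space `K^σ`, mapped to symmetric matrices by a polynomial map
`φ` whose coordinates can be recovered, as regular functions, from the point `[φ x]`. The dimension
is then the number of coordinates, and `dim_closure_projImage` makes this precise.

* Upper bound. A chain of irreducible closed subsets `W₀ ⊂ ⋯ ⊂ Wₘ` of the closure of the cell gives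
  a chain of primes: the ideal of the origin, followed by the ideals of the cones over the `Wᵢ`.
  Successive choices of elements of one prime outside the next are algebraically independent modulo
  the smallest prime (`exists_algebraicIndependent_of_chain`). That prime contains the kernel of the
  substitution `z ↦ c • φ x` into a polynomial ring in `σ` and one further variable `c`, so
  `m + 1 ≤ #σ + 1`.
* Lower bound. A flag of coordinate subspaces of `K^σ` gives a chain of irreducible closed subsets;
  it is strict because each coordinate is a quotient of homogeneous polynomials of the same degree
  on the cell.
* Density. Every symplectic matrix is `u₊(S) u₋(T) diag(g, g⁻ᵗ) u₊(R)` with `S`, `T`, `R` symmetric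
  and `g` invertible (`exists_eq_bruhat`). Moving these parameters along lines shows that orbits are
  irreducible, so a nonempty open part of an orbit is dense in it (`orbit_subset_closure`).

For the identity, the orbit consists of symmetric symplectic matrices. Where the upper left block is
invertible such a matrix is `((A, AS), (SA, SAS + A⁻¹))` with `A` and `S` symmetric. Normalizing one
diagonal entry of `A` replaces `A⁻¹` by `μ A⁻¹`, which leaves `r (r + 1)` parameters. For `I_k` with
`k ≤ r`, the orbit consists of matrices of rank `k` with isotropic image. On the cell such a matrix
is `((W, WT), (TW, TWT))` with `W = (1; b) D (1; b)ᵗ` and `T = ((s, dᵗ), (d, 0))`, where `D` and `s`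
are symmetric of size `k`, while `b` and `d` are arbitrary of size `(r - k) × k`. Conversely these
matrices lie in the orbits because a nondegenerate symmetric matrix over an algebraically closed
field is of the form `g gᵗ`.
-/

namespace SymplecticQuadrics

/-! ### Chains of prime ideals and algebraic independence -/

/-- An algebraically independent family which stays independent in the quotient `B` can be enlarged
by a nonzero element of the kernel. -/
theorem algebraicIndependent_option_of_ker {K A B ι : Type*} [Field K] [CommRing A] [IsDomain A]
    [CommRing B] [Algebra K A] [Algebra K B] (π : A →ₐ[K] B) {x : ι → A}
    (hx : AlgebraicIndependent K (π ∘ x)) {a : A} (ha : a ≠ 0) (hπ : π a = 0) :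
    AlgebraicIndependent K (fun o : Option ι => o.elim a x) := by
  have hx' : AlgebraicIndependent K x := hx.of_comp π
  rw [hx'.option_iff_transcendental]
  intro halg
  obtain ⟨q, hq0, hq⟩ :=
    halg.exists_nonzero_coeff_and_aeval_eq_zero (mem_nonZeroDivisors_of_ne_zero ha)
  apply hq0
  -- the constant coefficient is a multiple of `a`, so it dies in `B`
  have h1 : π (q.coeff 0 : A) = 0 := by
    have h2 := Polynomial.divX_mul_X_add q
    have h3 : Polynomial.aeval a q.divX * a + (q.coeff 0 : A) = 0 := by
      rw [← hq]
      conv_rhs => rw [← h2]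
      simp
    have := congrArg π h3
    simpa [hπ] using this
  obtain ⟨p, hp⟩ : ∃ p : MvPolynomial ι K, MvPolynomial.aeval x p = (q.coeff 0 : A) := by
    have h : ∀ y ∈ Algebra.adjoin K (Set.range x),
        ∃ p : MvPolynomial ι K, MvPolynomial.aeval x p = y := by
      rw [Algebra.adjoin_range_eq_range_aeval]
      exact fun y hy => hy
    exact h _ (q.coeff 0).2
  have h4 : MvPolynomial.aeval (π ∘ x) p = 0 := by
    have h5 : MvPolynomial.aeval (π ∘ x) p = π (MvPolynomial.aeval x p) := by
      rw [← AlgHom.comp_apply, MvPolynomial.comp_aeval]; rfl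
    rw [h5, hp, h1]
  have h6 : p = 0 := (injective_iff_map_eq_zero _).1 hx p h4
  exact Subtype.ext (by rw [← hp, h6]; simp)

/-- A chain of primes of length `n` yields `n` elements which are algebraically independent modulo
the smallest prime. -/
theorem exists_algebraicIndependent_of_chain {K R : Type*} [Field K] [CommRing R] [Algebra K R]
    (P : ℕ → Ideal R) (n : ℕ) (hP : ∀ i ≤ n, (P i).IsPrime) (hlt : ∀ i < n, P (i + 1) < P i) :
    ∃ f : Fin n → R, AlgebraicIndependent K fun i => Ideal.Quotient.mkₐ K (P n) (f i) := by
  induction n with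
  | zero =>
    have := hP 0 le_rfl
    exact ⟨Fin.elim0, algebraicIndependent_empty_type⟩
  | succ n ih =>
    obtain ⟨f, hf⟩ := ih (fun i hi => hP i (by omega)) (fun i hi => hlt i (by omega))
    have := hP (n + 1) le_rfl
    have hle := hlt n (by omega)
    obtain ⟨g, hg, hg'⟩ := SetLike.exists_of_lt hle
    have key := algebraicIndependent_option_of_ker (K := K)
      (Ideal.Quotient.factorₐ K hle.le)
      (x := fun i => Ideal.Quotient.mkₐ K (P (n + 1)) (f i))
      hf
      (a := Ideal.Quotient.mkₐ K (P (n + 1)) g)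
      (by simpa [Ideal.Quotient.eq_zero_iff_mem] using hg')
      (by simpa [Ideal.Quotient.eq_zero_iff_mem] using hg)
    refine ⟨Fin.cons g f, ?_⟩
    have h : (fun o : Option (Fin n) => o.elim (Ideal.Quotient.mkₐ K (P (n + 1)) g)
        fun i => Ideal.Quotient.mkₐ K (P (n + 1)) (f i)) =
        (fun i => Ideal.Quotient.mkₐ K (P (n + 1)) ((Fin.cons g f : Fin (n + 1) → R) i)) ∘
          (finSuccEquiv n).symm := by
      ext o
      cases o <;> simp
    rw [h] at key
    exact (algebraicIndependent_equiv (finSuccEquiv n).symm).1 key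

/-- If the smallest prime of a chain contains the kernel of a homomorphism to a polynomial ring,
then the length of the chain is at most the number of variables. -/
theorem length_le_card_of_chain {K R σ : Type*} [Field K] [CommRing R] [Algebra K R] [Finite σ]
    (ψ : R →ₐ[K] MvPolynomial σ K)
    (P : ℕ → Ideal R) (n : ℕ) (hP : ∀ i ≤ n, (P i).IsPrime) (hlt : ∀ i < n, P (i + 1) < P i)
    (hψ : ∀ p, ψ p = 0 → p ∈ P n) : n ≤ Nat.card σ := by
  obtain ⟨f, hf⟩ := exists_algebraicIndependent_of_chain (K := K) P n hP hlt
  have h1 : AlgebraicIndependent K (ψ ∘ f) := by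
    refine (injective_iff_map_eq_zero _).2 fun p hp => ?_
    refine (injective_iff_map_eq_zero _).1 hf p ?_
    have h2 : ψ (MvPolynomial.aeval f p) = 0 := by
      rw [← hp, ← AlgHom.comp_apply, MvPolynomial.comp_aeval]
      rfl
    have h3 := hψ _ h2
    have h4 : MvPolynomial.aeval (fun i => Ideal.Quotient.mkₐ K (P n) (f i)) p =
        Ideal.Quotient.mkₐ K (P n) (MvPolynomial.aeval f p) := by
      rw [← AlgHom.comp_apply, MvPolynomial.comp_aeval]
    exact h4.trans (Ideal.Quotient.eq_zero_iff_mem.2 h3)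
  have h2 := h1.lift_cardinalMk_le_trdeg
  rw [MvPolynomial.trdeg_of_isDomain] at h2
  simp only [Cardinal.mk_fin, Cardinal.lift_natCast, Cardinal.lift_lift] at h2
  have h3 := Nat.cast_card (α := σ)
  rw [← h3] at h2
  simpa using h2

/-! ### Cone ideals of subsets of projective space -/

section Cone

variable {K : Type*} [Field K] {r : ℕ}

theorem mem_closure_iff_forall_homogeneous {S : Set (PSym K r)} {x : PSym K r} :
    x ∈ closure S ↔ ∀ (p : EntryPoly K r) (d : ℕ), p.IsHomogeneous d →
      (∀ y ∈ S, evalAt y.rep p = 0) → evalAt x.rep p = 0 := by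
  constructor
  · intro hx p d hp hS
    have hcl : IsClosed (projZeros {p} : Set (PSym K r)) := by
      rw [isClosed_iff_isAlgebraic]
      exact ⟨{p}, fun q hq => ⟨d, by rwa [Set.mem_singleton_iff.1 hq]⟩, rfl⟩
    have : closure S ⊆ projZeros {p} :=
      closure_minimal (fun y hy q hq => by rw [Set.mem_singleton_iff.1 hq]; exact hS y hy) hcl
    exact this hx p rfl
  · intro h
    have hcl : IsClosed (closure S) := isClosed_closure
    obtain ⟨T, hT, hST⟩ := (isClosed_iff_isAlgebraic _).1 hcl
    rw [hST]
    intro p hp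
    obtain ⟨d, hd⟩ := hT p hp
    refine h p d hd fun y hy => ?_
    have : y ∈ projZeros T := hST ▸ subset_closure hy
    exact this p hp

theorem evalAt_rep_mk_eq_zero_iff {p : EntryPoly K r} {d : ℕ} (hp : p.IsHomogeneous d)
    (Z : SymMat K r) (hZ : Z ≠ 0) :
    evalAt (Projectivization.mk K Z hZ).rep p = 0 ↔ evalAt Z p = 0 := by
  have := mk_mem_projZeros (S := {p}) (fun q hq => ⟨d, by rwa [Set.mem_singleton_iff.1 hq]⟩) Z hZ
  simpa [projZeros] using this

/-- Irreducibility can be tested on the complements of single hypersurfaces. -/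
theorem isPreirreducible_of_forall_homogeneous {S : Set (PSym K r)}
    (h : ∀ (p q : EntryPoly K r) (d e : ℕ), p.IsHomogeneous d → q.IsHomogeneous e →
      ∀ x ∈ S, ∀ y ∈ S, evalAt x.rep p ≠ 0 → evalAt y.rep q ≠ 0 →
      ∃ z ∈ S, evalAt z.rep p ≠ 0 ∧ evalAt z.rep q ≠ 0) : IsPreirreducible S := by
  rintro U V hU hV ⟨x, hxS, hxU⟩ ⟨y, hyS, hyV⟩
  obtain ⟨A, hA, hUA⟩ := (isClosed_iff_isAlgebraic _).1 hU.isClosed_compl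
  obtain ⟨B, hB, hVB⟩ := (isClosed_iff_isAlgebraic _).1 hV.isClosed_compl
  have hx : x ∉ projZeros A := hUA ▸ fun h => h hxU
  have hy : y ∉ projZeros B := hVB ▸ fun h => h hyV
  simp only [projZeros, Set.mem_ofPred_eq, not_forall] at hx hy
  obtain ⟨p, hp, hpx⟩ := hx
  obtain ⟨q, hq, hqy⟩ := hy
  obtain ⟨d, hd⟩ := hA p hp
  obtain ⟨e, he⟩ := hB q hq
  obtain ⟨z, hz, hzp, hzq⟩ := h p q d e hd he x hxS y hyS hpx hqy
  refine ⟨z, hz, ?_, ?_⟩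
  · by_contra hzU
    have : z ∈ projZeros A := hUA ▸ hzU
    exact hzp (this p hp)
  · by_contra hzV
    have : z ∈ projZeros B := hVB ▸ hzV
    exact hzq (this q hq)

theorem evalAt_smul_eq_sum (c : K) (Z : SymMat K r) (p : EntryPoly K r) :
    evalAt (c • Z) p = ∑ d ∈ Finset.range (p.totalDegree + 1),
      c ^ d * evalAt Z (p.homogeneousComponent d) := by
  conv_lhs => rw [← p.sum_homogeneousComponent]
  have : ∀ (W : SymMat K r) (s : Finset ℕ) (f : ℕ → EntryPoly K r),
      evalAt W (∑ d ∈ s, f d) = ∑ d ∈ s, evalAt W (f d) := fun W s f => by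
    simp [evalAt]
  rw [this]
  exact Finset.sum_congr rfl fun d _ =>
    evalAt_smul c Z (p.homogeneousComponent_isHomogeneous d)

/-- A polynomial vanishing on the punctured line through `Z` has all its homogeneous components
vanishing at `Z`, as a polynomial in the scalar with infinitely many zeros. -/
theorem evalAt_homogeneousComponent_eq_zero [Infinite K] {Z : SymMat K r} {p : EntryPoly K r}
    (h : ∀ c : K, c ≠ 0 → evalAt (c • Z) p = 0) (d : ℕ) :
    evalAt Z (p.homogeneousComponent d) = 0 := by
  set q : Polynomial K := ∑ d ∈ Finset.range (p.totalDegree + 1),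
    Polynomial.C (evalAt Z (p.homogeneousComponent d)) * Polynomial.X ^ d with hq
  have hq0 : q = 0 := by
    have : Polynomial.X * q = 0 := by
      refine Polynomial.funext fun c => ?_
      by_cases hc : c = 0
      · simp [hc]
      · have := h c hc
        rw [evalAt_smul_eq_sum] at this
        simp only [Polynomial.eval_mul, Polynomial.eval_X, Polynomial.eval_zero, hq,
          Polynomial.eval_finsetSum, Polynomial.eval_C, Polynomial.eval_pow, mul_eq_zero]
        right
        rw [← this]
        exact Finset.sum_congr rfl fun _ _ => mul_comm _ _
    simpa using this
  by_cases hd : d ≤ p.totalDegree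
  · have := congrArg (fun q => Polynomial.coeff q d) hq0
    simpa [hq, Polynomial.finsetSum_coeff, Polynomial.coeff_C_mul, Polynomial.coeff_X_pow, hd,
      Nat.lt_succ_iff] using this
  · rw [MvPolynomial.homogeneousComponent_eq_zero _ _ (by omega)]
    simp [evalAt]

/-- The ideal of the affine cone over a subset of `ℙ^N`. -/
def coneIdeal (W : Set (PSym K r)) : Ideal (EntryPoly K r) where
  carrier := {p | ∀ (Z : SymMat K r) (hZ : Z ≠ 0), Projectivization.mk K Z hZ ∈ W → evalAt Z p = 0}
  add_mem' := fun ha hb Z hZ hW => by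
    have h1 := ha Z hZ hW
    have h2 := hb Z hZ hW
    simp_all [evalAt]
  zero_mem' := fun Z _ _ => by simp [evalAt]
  smul_mem' := fun c p hp Z hZ hW => by
    have h1 := hp Z hZ hW
    simp_all [evalAt]

theorem mem_coneIdeal_of_isHomogeneous {W : Set (PSym K r)} {p : EntryPoly K r} {d : ℕ}
    (hp : p.IsHomogeneous d) : p ∈ coneIdeal W ↔ ∀ x ∈ W, evalAt x.rep p = 0 := by
  constructor
  · intro h x hx
    exact h x.rep x.rep_nonzero (by rwa [x.mk_rep])
  · intro h Z hZ hW
    exact (evalAt_rep_mk_eq_zero_iff hp Z hZ).1 (h _ hW)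

theorem homogeneousComponent_mem_coneIdeal [Infinite K] {W : Set (PSym K r)} {p : EntryPoly K r}
    (hp : p ∈ coneIdeal W) (d : ℕ) : p.homogeneousComponent d ∈ coneIdeal W := by
  intro Z hZ hW
  refine evalAt_homogeneousComponent_eq_zero (fun c hc => ?_) d
  refine hp (c • Z) (smul_ne_zero hc hZ) ?_
  convert hW using 1
  rw [Projectivization.mk_eq_mk_iff']
  exact ⟨c, rfl⟩

theorem coneIdeal_anti {V W : Set (PSym K r)} (h : V ⊆ W) : coneIdeal W ≤ coneIdeal V :=
  fun _ hp Z hZ hV => hp Z hZ (h hV)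

theorem coneIdeal_lt {V W : Set (PSym K r)} (hV : IsClosed V) (h : V ⊂ W) :
    coneIdeal W < coneIdeal V := by
  refine lt_of_le_of_ne (coneIdeal_anti h.1) fun heq => h.2 fun x hx => ?_
  rw [← hV.closure_eq, mem_closure_iff_forall_homogeneous]
  intro p d hp hp'
  have : p ∈ coneIdeal W := heq ▸ (mem_coneIdeal_of_isHomogeneous hp).2 hp'
  exact (mem_coneIdeal_of_isHomogeneous hp).1 this x hx

theorem coneIdeal_isPrime [Infinite K] {W : Set (PSym K r)} (hW : IsIrreducible W) :
    (coneIdeal W).IsPrime := by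
  let _ := MvPolynomial.gradedAlgebra (σ := (Fin r ⊕ Fin r) × (Fin r ⊕ Fin r)) (R := K)
  have hom : (coneIdeal W).IsHomogeneous
      (MvPolynomial.homogeneousSubmodule ((Fin r ⊕ Fin r) × (Fin r ⊕ Fin r)) K) := by
    intro d p hp
    have h := MvPolynomial.decomposition.decompose'_apply (R := K) p d
    exact h ▸ homogeneousComponent_mem_coneIdeal hp d
  refine hom.isPrime_of_homogeneous_mem_or_mem ?_ ?_
  · intro htop
    obtain ⟨x, hx⟩ := hW.nonempty
    have h1 : (1 : EntryPoly K r) ∈ coneIdeal W := htop ▸ Submodule.mem_top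
    have := h1 x.rep x.rep_nonzero (by rwa [x.mk_rep])
    simp [evalAt] at this
  · rintro p q ⟨d, hp⟩ ⟨e, hq⟩ hpq
    rw [MvPolynomial.mem_homogeneousSubmodule] at hp hq
    rw [mem_coneIdeal_of_isHomogeneous (hp.mul hq)] at hpq
    rw [mem_coneIdeal_of_isHomogeneous hp, mem_coneIdeal_of_isHomogeneous hq]
    have hcl : ∀ (f : EntryPoly K r) (m : ℕ), f.IsHomogeneous m →
        IsClosed (projZeros {f} : Set (PSym K r)) := fun f m hf => by
      rw [isClosed_iff_isAlgebraic]
      exact ⟨{f}, fun q hq => ⟨m, by rwa [Set.mem_singleton_iff.1 hq]⟩, rfl⟩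
    have hcov : W ⊆ projZeros {p} ∪ projZeros {q} := fun x hx => by
      have := hpq x hx
      simpa [evalAt, projZeros] using this
    rcases isPreirreducible_iff_isClosed_union_isClosed.1 hW.isPreirreducible _ _
      (hcl p d hp) (hcl q e hq) hcov with h | h
    · exact Or.inl fun x hx => h hx p rfl
    · exact Or.inr fun x hx => h hx q rfl

theorem coneIdeal_lt_ker_evalAt_zero [Infinite K] {W : Set (PSym K r)} (hW : W.Nonempty) :
    coneIdeal W < RingHom.ker (MvPolynomial.eval
      (0 : (Fin r ⊕ Fin r) × (Fin r ⊕ Fin r) → K)) := by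
  obtain ⟨x, hx⟩ := hW
  have hx' : Projectivization.mk K x.rep x.rep_nonzero ∈ W := by rwa [x.mk_rep]
  refine lt_of_le_of_ne (fun p hp => ?_) fun heq => ?_
  · have h1 := homogeneousComponent_mem_coneIdeal hp 0 x.rep x.rep_nonzero hx'
    rw [MvPolynomial.homogeneousComponent_zero] at h1
    rw [RingHom.mem_ker, MvPolynomial.eval_zero, MvPolynomial.constantCoeff_eq]
    simpa [evalAt] using h1
  · apply x.rep_nonzero
    ext i j
    have h1 : (MvPolynomial.X (i, j) : EntryPoly K r) ∈ coneIdeal W := by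
      rw [heq, RingHom.mem_ker]; simp
    simpa [evalAt] using h1 x.rep x.rep_nonzero hx'

end Cone

/-! ### Matrices with entries in an algebra of functions -/

section FunctionMatrices

variable {K X : Type*} [Field K] (A : Subalgebra K (X → K)) {l m n o : Type*}

/-- A matrix-valued function on `X` has entries in the algebra `A` of functions on `X`. -/
def MatMem (M : X → Matrix m n K) : Prop := ∀ i j, (fun x => M x i j) ∈ A

variable {A}

theorem MatMem.const (M : Matrix m n K) : MatMem A fun _ => M :=
  fun i j => A.algebraMap_mem (M i j)

theorem MatMem.add {M N : X → Matrix m n K} (hM : MatMem A M) (hN : MatMem A N) :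
    MatMem A fun x => M x + N x :=
  fun i j => A.add_mem (hM i j) (hN i j)

theorem MatMem.sub {M N : X → Matrix m n K} (hM : MatMem A M) (hN : MatMem A N) :
    MatMem A fun x => M x - N x :=
  fun i j => A.sub_mem (hM i j) (hN i j)

theorem MatMem.smul {f : X → K} {M : X → Matrix m n K} (hf : f ∈ A) (hM : MatMem A M) :
    MatMem A fun x => f x • M x :=
  fun i j => A.mul_mem hf (hM i j)

theorem MatMem.transpose {M : X → Matrix m n K} (hM : MatMem A M) : MatMem A fun x => (M x)ᵀ :=
  fun i j => hM j i

theorem MatMem.submatrix {M : X → Matrix m n K} (hM : MatMem A M) (f : l → m) (g : o → n) :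
    MatMem A fun x => (M x).submatrix f g :=
  fun i j => hM (f i) (g j)

theorem MatMem.fromBlocks {M : X → Matrix m n K} {N : X → Matrix m o K} {P : X → Matrix l n K}
    {Q : X → Matrix l o K} (hM : MatMem A M) (hN : MatMem A N) (hP : MatMem A P)
    (hQ : MatMem A Q) : MatMem A fun x => Matrix.fromBlocks (M x) (N x) (P x) (Q x) := by
  rintro (i | i) (j | j)
  exacts [hM i j, hN i j, hP i j, hQ i j]

theorem sum_fun_mem {ι : Type*} (s : Finset ι) (f : ι → X → K) (hf : ∀ i ∈ s, f i ∈ A) :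
    (fun x => ∑ i ∈ s, f i x) ∈ A := by
  have := A.sum_mem hf
  rwa [show (∑ i ∈ s, f i) = fun x => ∑ i ∈ s, f i x from by ext x; simp] at this

theorem prod_fun_mem {ι : Type*} (s : Finset ι) (f : ι → X → K) (hf : ∀ i ∈ s, f i ∈ A) :
    (fun x => ∏ i ∈ s, f i x) ∈ A := by
  have := A.prod_mem hf
  rwa [show (∏ i ∈ s, f i) = fun x => ∏ i ∈ s, f i x from by ext x; simp] at this

theorem MatMem.mul [Fintype m] {M : X → Matrix l m K} {N : X → Matrix m n K} (hM : MatMem A M)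
    (hN : MatMem A N) : MatMem A fun x => M x * N x := by
  intro i j
  simp only [Matrix.mul_apply]
  exact sum_fun_mem _ _ fun k _ => A.mul_mem (hM i k) (hN k j)

theorem MatMem.det [Fintype m] [DecidableEq m] {M : X → Matrix m m K} (hM : MatMem A M) :
    (fun x => (M x).det) ∈ A := by
  simp only [Matrix.det_apply]
  refine sum_fun_mem _ _ fun s _ => ?_
  have h : (fun x => ∏ i, M x (s i) i) ∈ A := prod_fun_mem _ _ fun i _ => hM (s i) i
  rcases Int.units_eq_one_or (Equiv.Perm.sign s) with hs | hs
  · simpa [hs] using h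
  · have := A.neg_mem h
    rw [hs]
    convert this using 1
    ext x
    simp

theorem MatMem.adjugate [Fintype m] [DecidableEq m] {M : X → Matrix m m K} (hM : MatMem A M) :
    MatMem A fun x => (M x).adjugate := by
  intro i j
  simp only [Matrix.adjugate_apply]
  refine MatMem.det fun a b => ?_
  by_cases h : a = j
  · subst h
    simp only [Matrix.updateRow_self]
    exact A.algebraMap_mem (Pi.single (M := fun _ => K) i 1 b)
  · simpa [Matrix.updateRow_ne h] using hM a b

theorem MatMem.inv [Fintype m] [DecidableEq m] {M : X → Matrix m m K} (hM : MatMem A M)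
    (hA : (fun x => (M x).det)⁻¹ ∈ A) : MatMem A fun x => (M x)⁻¹ := by
  simp only [Matrix.inv_def, Ring.inverse_eq_inv']
  exact hM.adjugate.smul hA

end FunctionMatrices

/-! ### Polynomial functions, and functions polynomial on lines -/

/-- Polynomial functions on the affine space `K^σ`. -/
noncomputable def polyFun (K σ : Type*) [Field K] : Subalgebra K ((σ → K) → K) :=
  (MvPolynomial.aeval fun (i : σ) (x : σ → K) => x i).range

theorem mem_polyFun {K σ : Type*} [Field K] {f : (σ → K) → K} :
    f ∈ polyFun K σ ↔ ∃ p : MvPolynomial σ K, ∀ x, MvPolynomial.eval x p = f x := by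
  have h : ∀ (p : MvPolynomial σ K) (x : σ → K),
      MvPolynomial.aeval (fun (i : σ) (x : σ → K) => x i) p x = MvPolynomial.eval x p := by
    intro p x
    induction p using MvPolynomial.induction_on with
    | C a => simp
    | add p q hp hq => simp [hp, hq]
    | mul_X p i hp => simp [hp]
  refine exists_congr fun p => ?_
  rw [funext_iff]
  exact forall_congr' fun x => by rw [← h]; rfl

theorem coord_mem_polyFun {K σ : Type*} [Field K] (i : σ) :
    (fun x : σ → K => x i) ∈ polyFun K σ :=
  mem_polyFun.2 ⟨MvPolynomial.X i, by simp⟩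

/-- Functions on a vector space whose restriction to every affine line is polynomial. -/
def lineFun (K E : Type*) [Field K] [AddCommGroup E] [Module K E] : Subalgebra K (E → K) where
  carrier := {f | ∀ x y : E, ∃ p : Polynomial K, ∀ t, p.eval t = f (AffineMap.lineMap x y t)}
  mul_mem' := fun ha hb x y => by
    obtain ⟨p, hp⟩ := ha x y
    obtain ⟨q, hq⟩ := hb x y
    exact ⟨p * q, fun t => by simp [hp, hq]⟩
  add_mem' := fun ha hb x y => by
    obtain ⟨p, hp⟩ := ha x y
    obtain ⟨q, hq⟩ := hb x y
    exact ⟨p + q, fun t => by simp [hp, hq]⟩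
  algebraMap_mem' := fun c x y => ⟨Polynomial.C c, fun t => by simp⟩

theorem linearMap_mem_lineFun {K E : Type*} [Field K] [AddCommGroup E] [Module K E]
    (f : E →ₗ[K] K) : (f : E → K) ∈ lineFun K E := fun x y =>
  ⟨Polynomial.X * Polynomial.C (f y - f x) + Polynomial.C (f x), fun t => by
    simp [AffineMap.lineMap_apply]⟩

theorem polyFun_le_lineFun (K σ : Type*) [Field K] : polyFun K σ ≤ lineFun K (σ → K) := by
  rintro _ ⟨p, rfl⟩
  rw [AlgHom.toRingHom_eq_coe, RingHom.coe_coe]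
  induction p using MvPolynomial.induction_on with
  | C a =>
    rw [MvPolynomial.algHom_C]
    exact (lineFun K (σ → K)).algebraMap_mem a
  | add p q hp hq =>
    rw [map_add]
    exact (lineFun K (σ → K)).add_mem hp hq
  | mul_X p i hp =>
    rw [map_mul]
    refine (lineFun K (σ → K)).mul_mem hp ?_
    simpa using linearMap_mem_lineFun (LinearMap.proj (R := K) (φ := fun _ : σ => K) i)

/-- Two functions which are polynomial on lines, the first nonzero at `x` and the second nonzero at
`y`, are both nonzero somewhere on the line through `x` and `y`. -/
theorem exists_lineMap_ne_zero {K E : Type*} [Field K] [Infinite K] [AddCommGroup E] [Module K E]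
    {f g : E → K} (hf : f ∈ lineFun K E) (hg : g ∈ lineFun K E) {x y : E} (hx : f x ≠ 0)
    (hy : g y ≠ 0) :
    ∃ t : K, f (AffineMap.lineMap x y t) ≠ 0 ∧ g (AffineMap.lineMap x y t) ≠ 0 := by
  obtain ⟨p, hp⟩ := hf x y
  obtain ⟨q, hq⟩ := hg x y
  have hp0 : p ≠ 0 := by
    rintro rfl
    have := hp 0
    simp at this
    exact hx this.symm
  have hq0 : q ≠ 0 := by
    rintro rfl
    have := hq 1
    simp at this
    exact hy this.symm
  by_contra! h
  refine mul_ne_zero hp0 hq0 (Polynomial.funext fun t => ?_)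
  rw [Polynomial.eval_mul, hp, hq, Polynomial.eval_zero, mul_eq_zero]
  exact or_iff_not_imp_left.2 (h t)

/-! ### Dimension of the closure of a polynomially parametrized set -/

section Zariski

variable {K : Type*} [Field K] {r : ℕ}

theorem evalAt_mem {X : Type*} {A : Subalgebra K (X → K)} {φ : X → SymMat K r}
    (hφ : MatMem A fun x => (φ x : Matrix (Fin r ⊕ Fin r) (Fin r ⊕ Fin r) K)) (p : EntryPoly K r) :
    (fun x => evalAt (φ x) p) ∈ A := by
  induction p using MvPolynomial.induction_on with
  | C a =>
    simp only [evalAt, MvPolynomial.eval_C]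
    exact A.algebraMap_mem a
  | add p q hp hq =>
    simp only [evalAt, map_add]
    exact A.add_mem hp hq
  | mul_X p i hp =>
    simp only [evalAt, map_mul, MvPolynomial.eval_X]
    exact A.mul_mem hp (hφ i.1 i.2)

/-- The set of points `[φ x]` of `ℙ^N`, for `x ∈ U` with `φ x ≠ 0`. -/
def projImage {X : Type*} (φ : X → SymMat K r) (U : Set X) : Set (PSym K r) :=
  {y | ∃ x ∈ U, ∃ h : φ x ≠ 0, y = Projectivization.mk K (φ x) h}

theorem projImage_mono {X : Type*} (φ : X → SymMat K r) {U V : Set X} (h : U ⊆ V) :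
    projImage φ U ⊆ projImage φ V := by
  rintro _ ⟨x, hx, hne, rfl⟩
  exact ⟨x, h hx, hne, rfl⟩

/-- A chain of irreducible closed subsets of the closure of the image of a polynomial map from
affine `n`-space has length at most `n`. -/
theorem length_le_card_of_projImage [Infinite K] {σ : Type*} [Finite σ] {φ : (σ → K) → SymMat K r}
    (hφ : MatMem (polyFun K σ) fun x => (φ x : Matrix (Fin r ⊕ Fin r) (Fin r ⊕ Fin r) K))
    (U : Set (σ → K)) (l : LTSeries (TopologicalSpace.IrreducibleCloseds (PSym K r)))
    (hl : (l.last : Set (PSym K r)) ⊆ closure (projImage φ U)) : l.length ≤ Nat.card σ := by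
  choose Φ hΦ using fun i j => mem_polyFun.1 (hφ i j)
  set n := l.length with hn
  let W : ℕ → TopologicalSpace.IrreducibleCloseds (PSym K r) := fun i =>
    l ⟨min i n, by omega⟩
  -- the chain of prime ideals starts with the ideal of the origin
  let P : ℕ → Ideal (EntryPoly K r) := fun i => Nat.casesOn i
    (RingHom.ker (MvPolynomial.eval (0 : (Fin r ⊕ Fin r) × (Fin r ⊕ Fin r) → K)))
    fun i => coneIdeal (W i)
  -- substitution of the generic point of the cone over the image of `φ`; `none` is the scalar
  let ψ : EntryPoly K r →ₐ[K] MvPolynomial (Option σ) K := MvPolynomial.aeval fun ij =>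
    MvPolynomial.X none * MvPolynomial.rename some (Φ ij.1 ij.2)
  have hψ : ∀ p (c : K) (x : σ → K),
      MvPolynomial.eval (fun o : Option σ => o.elim c x) (ψ p) = evalAt (c • φ x) p := by
    intro p c x
    induction p using MvPolynomial.induction_on with
    | C a => simp [ψ, evalAt]
    | add p q hp hq => simp_all [evalAt]
    | mul_X p i hp =>
      have h1 : MvPolynomial.eval (fun o : Option σ => o.elim c x) (ψ (MvPolynomial.X i)) =
          evalAt (c • φ x) (MvPolynomial.X i) := by
        simp only [ψ, MvPolynomial.aeval_X, map_mul, MvPolynomial.eval_X,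
          MvPolynomial.eval_rename, evalAt, Submodule.coe_smul, Matrix.smul_apply, smul_eq_mul,
          Option.elim_none, ← hΦ]
        rfl
      rw [map_mul, map_mul, hp, h1]
      simp [evalAt]
  have key := length_le_card_of_chain ψ P (n + 1) ?_ ?_ ?_
  · rw [Finite.card_option] at key
    omega
  · rintro (_ | i) hi
    · exact RingHom.ker_isPrime _
    · exact coneIdeal_isPrime (W i).isIrreducible
  · rintro (_ | i) hi
    · exact coneIdeal_lt_ker_evalAt_zero (W 0).isIrreducible.nonempty
    · refine coneIdeal_lt (W i).isClosed ?_
      have : W i < W (i + 1) := l.strictMono (by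
        rw [Fin.mk_lt_mk, min_eq_left (by omega), min_eq_left (by omega)]; omega)
      exact this
  · intro p hp
    refine coneIdeal_anti (W := closure (projImage φ U)) ?_ ?_
    · have : W n = l.last := by
        simp only [W, RelSeries.last]
        congr 1
        ext
        simp [hn]
      rw [this]
      exact hl
    · -- a polynomial killed by `ψ` has homogeneous components vanishing on the image of `φ`
      have h1 : ∀ d, ∀ x, evalAt (φ x) (p.homogeneousComponent d) = 0 := fun d x =>
        evalAt_homogeneousComponent_eq_zero (fun c _ => by rw [← hψ, hp, map_zero]) d
      rw [← p.sum_homogeneousComponent]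
      refine Ideal.sum_mem _ fun d _ => ?_
      have hd := p.homogeneousComponent_isHomogeneous d
      rw [mem_coneIdeal_of_isHomogeneous hd]
      intro y hy
      refine mem_closure_iff_forall_homogeneous.1 hy _ d hd ?_
      rintro _ ⟨x, _, hx, rfl⟩
      exact (evalAt_rep_mk_eq_zero_iff hd _ hx).2 (h1 d x)

theorem topologicalKrullDim_closure_projImage_le [Infinite K] {σ : Type*} [Finite σ]
    {φ : (σ → K) → SymMat K r}
    (hφ : MatMem (polyFun K σ) fun x => (φ x : Matrix (Fin r ⊕ Fin r) (Fin r ⊕ Fin r) K))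
    (U : Set (σ → K)) :
    topologicalKrullDim (closure (projImage φ U)) ≤ (Nat.card σ : WithBot ℕ∞) := by
  refine iSup_le fun l => ?_
  have h := length_le_card_of_projImage hφ U
    (l.map _ (TopologicalSpace.IrreducibleCloseds.map_strictMono_of_isInducing
      Topology.IsInducing.subtypeVal)) (by
      refine closure_minimal ?_ isClosed_closure
      rintro _ ⟨y, _, rfl⟩
      exact y.2)
  exact_mod_cast h

theorem le_topologicalKrullDim_of_chain {X : Type*} [TopologicalSpace X] {T : Set X} {n : ℕ}
    (W : Fin (n + 1) → Set X) (hc : ∀ i, IsClosed (W i)) (hi : ∀ i, IsIrreducible (W i))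
    (hT : ∀ i, W i ⊆ T) (hlt : StrictMono W) : (n : WithBot ℕ∞) ≤ topologicalKrullDim T := by
  let V : Fin (n + 1) → TopologicalSpace.IrreducibleCloseds T := fun i =>
    { carrier := Subtype.val ⁻¹' W i
      isIrreducible' := by
        refine ⟨?_, ?_⟩
        · obtain ⟨x, hx⟩ := (hi i).nonempty
          exact ⟨⟨x, hT i hx⟩, hx⟩
        · rintro _ _ ⟨u, hu, rfl⟩ ⟨v, hv, rfl⟩ ⟨x, hx, hxu⟩ ⟨y, hy, hyv⟩
          obtain ⟨z, hz, hzu, hzv⟩ := (hi i).isPreirreducible u v hu hv ⟨x, hx, hxu⟩ ⟨y, hy, hyv⟩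
          exact ⟨⟨z, hT i hz⟩, hz, hzu, hzv⟩
      isClosed' := (hc i).preimage continuous_subtype_val }
  have hV : StrictMono V := by
    intro i j hij
    have h := hlt hij
    refine lt_of_le_of_ne (fun x hx => h.le hx) fun heq => h.not_ge fun x hx => ?_
    have hx' : (⟨x, hT j hx⟩ : T) ∈ V j := hx
    rw [← heq] at hx'
    exact hx'
  exact Order.LTSeries.length_le_krullDim (LTSeries.mk n V hV)

/-- The image of an open subset `{u ≠ 0}` of an affine subspace `L` is irreducible, since two
nonempty open subsets have a common point on a suitable line in `L`. -/
theorem isPreirreducible_projImage [Infinite K] {E : Type*} [AddCommGroup E] [Module K E]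
    {φ : E → SymMat K r}
    (hφ : MatMem (lineFun K E) fun x => (φ x : Matrix (Fin r ⊕ Fin r) (Fin r ⊕ Fin r) K))
    {u : E → K} (hu : u ∈ lineFun K E) {L : Set E}
    (hL : ∀ x ∈ L, ∀ y ∈ L, ∀ t : K, AffineMap.lineMap x y t ∈ L) :
    IsPreirreducible (projImage φ {x | x ∈ L ∧ u x ≠ 0}) := by
  refine isPreirreducible_of_forall_homogeneous ?_
  rintro p q d e hp hq _ ⟨x, ⟨hxL, hxu⟩, hx, rfl⟩ _ ⟨y, ⟨hyL, hyu⟩, hy, rfl⟩ hpx hqy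
  rw [Ne, evalAt_rep_mk_eq_zero_iff hp] at hpx
  rw [Ne, evalAt_rep_mk_eq_zero_iff hq] at hqy
  -- a linear form which does not vanish at `φ x`
  obtain ⟨i, j, hij⟩ : ∃ i j, (φ x : Matrix (Fin r ⊕ Fin r) (Fin r ⊕ Fin r) K) i j ≠ 0 := by
    by_contra! h
    exact hx (Subtype.ext (Matrix.ext h))
  obtain ⟨t, ht1, ht2⟩ := exists_lineMap_ne_zero (x := x) (y := y)
    ((lineFun K E).mul_mem (evalAt_mem hφ p) (hφ i j)) ((lineFun K E).mul_mem (evalAt_mem hφ q) hu)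
    (mul_ne_zero hpx hij) (mul_ne_zero hqy hyu)
  have h0 : φ (AffineMap.lineMap x y t) ≠ 0 := fun h =>
    right_ne_zero_of_mul ht1 (by simp [h])
  refine ⟨_, ⟨AffineMap.lineMap x y t, ⟨hL x hxL y hyL t, right_ne_zero_of_mul ht2⟩, h0, rfl⟩,
    ?_, ?_⟩
  · rw [Ne, evalAt_rep_mk_eq_zero_iff hp]
    exact left_ne_zero_of_mul ht1
  · rw [Ne, evalAt_rep_mk_eq_zero_iff hq]
    exact left_ne_zero_of_mul ht2

/-- The functions on `U` which are pulled back, along `φ`, from quotients of homogeneous polynomials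
of the same degree. -/
def regFun {X : Type*} (φ : X → SymMat K r) (U : Set X) : Subalgebra K (U → K) where
  carrier := {g | ∃ (d : ℕ) (f h : EntryPoly K r), f.IsHomogeneous d ∧ h.IsHomogeneous d ∧
    ∀ x : U, evalAt (φ x) h ≠ 0 ∧ evalAt (φ x) f = g x * evalAt (φ x) h}
  mul_mem' := by
    rintro g g' ⟨d, f, h, hf, hh, H⟩ ⟨d', f', h', hf', hh', H'⟩
    refine ⟨d + d', f * f', h * h', hf.mul hf', hh.mul hh', fun x => ?_⟩
    have e : ∀ p q, evalAt (φ x) (p * q) = evalAt (φ x) p * evalAt (φ x) q := by simp [evalAt]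
    rw [e, e, (H x).2, (H' x).2]
    exact ⟨mul_ne_zero (H x).1 (H' x).1, by simp; ring⟩
  add_mem' := by
    rintro g g' ⟨d, f, h, hf, hh, H⟩ ⟨d', f', h', hf', hh', H'⟩
    refine ⟨d + d', f * h' + h * f', h * h', (hf.mul hh').add (hh.mul hf'), hh.mul hh',
      fun x => ?_⟩
    have e : ∀ p q, evalAt (φ x) (p * q) = evalAt (φ x) p * evalAt (φ x) q := by simp [evalAt]
    have e' : ∀ p q, evalAt (φ x) (p + q) = evalAt (φ x) p + evalAt (φ x) q := by simp [evalAt]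
    rw [e', e, e, e, (H x).2, (H' x).2]
    exact ⟨mul_ne_zero (H x).1 (H' x).1, by simp; ring⟩
  algebraMap_mem' c := ⟨0, MvPolynomial.C c, 1, MvPolynomial.isHomogeneous_C _ _,
    MvPolynomial.isHomogeneous_one _ _, fun x => by simp [evalAt]⟩

theorem inv_mem_regFun {X : Type*} {φ : X → SymMat K r} {U : Set X} {g : U → K}
    (hg : g ∈ regFun φ U) (h0 : ∀ x, g x ≠ 0) : g⁻¹ ∈ regFun φ U := by
  obtain ⟨d, f, h, hf, hh, H⟩ := hg
  refine ⟨d, h, f, hh, hf, fun x => ?_⟩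
  rw [(H x).2]
  exact ⟨mul_ne_zero (h0 x) (H x).1, by simp [h0 x]⟩

theorem MatMem.inv_regFun {X m : Type*} [Fintype m] [DecidableEq m] {φ : X → SymMat K r}
    {U : Set X} {M : U → Matrix m m K} (hM : MatMem (regFun φ U) M) (h0 : ∀ x, (M x).det ≠ 0) :
    MatMem (regFun φ U) fun x => (M x)⁻¹ :=
  hM.inv (inv_mem_regFun hM.det h0)

/-- The entries of `φ x`, divided by an entry which does not vanish on `U`, are regular. -/
theorem matMem_regFun_smul {X : Type*} {φ : X → SymMat K r} {U : Set X} (a b : Fin r ⊕ Fin r)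
    (h0 : ∀ x ∈ U, (φ x : Matrix (Fin r ⊕ Fin r) (Fin r ⊕ Fin r) K) a b ≠ 0) :
    MatMem (regFun φ U) fun x : U =>
      ((φ x : Matrix (Fin r ⊕ Fin r) (Fin r ⊕ Fin r) K) a b)⁻¹ •
        (φ x : Matrix (Fin r ⊕ Fin r) (Fin r ⊕ Fin r) K) := fun i j =>
  ⟨1, MvPolynomial.X (i, j), MvPolynomial.X (a, b), MvPolynomial.isHomogeneous_X _ _,
    MvPolynomial.isHomogeneous_X _ _, fun x => ⟨by simpa [evalAt] using h0 x x.2, by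
      have := h0 x x.2
      simp [evalAt]
      field_simp⟩⟩

/-- The closure of the image of an open subset of affine `n`-space under a polynomial map, whose
coordinates are regular functions of the image point, is irreducible of dimension `n`. -/
theorem dim_closure_projImage [Infinite K] {σ : Type*} [Fintype σ]
    {φ : (σ → K) → SymMat K r}
    (hφ : MatMem (polyFun K σ) fun x => (φ x : Matrix (Fin r ⊕ Fin r) (Fin r ⊕ Fin r) K))
    {u : (σ → K) → K} (hu : u ∈ polyFun K σ) {x₀ : σ → K} (hx₀ : u x₀ ≠ 0)
    (hne : ∀ x, u x ≠ 0 → φ x ≠ 0)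
    (hreg : ∀ i : σ, (fun x : {x | u x ≠ 0} => x.1 i) ∈ regFun φ {x | u x ≠ 0}) :
    IsIrreducible (closure (projImage φ {x | u x ≠ 0})) ∧
    topologicalKrullDim (closure (projImage φ {x | u x ≠ 0})) =
      (Fintype.card σ : WithBot ℕ∞) := by
  have hφ' : MatMem (lineFun K (σ → K)) fun x =>
      (φ x : Matrix (Fin r ⊕ Fin r) (Fin r ⊕ Fin r) K) :=
    fun i j => polyFun_le_lineFun K σ (hφ i j)
  have hu' := polyFun_le_lineFun K σ hu
  have hirr : ∀ L : Set (σ → K), x₀ ∈ L →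
      (∀ x ∈ L, ∀ y ∈ L, ∀ t : K, AffineMap.lineMap x y t ∈ L) →
      IsIrreducible (closure (projImage φ {x | x ∈ L ∧ u x ≠ 0})) := fun L h0 hL =>
    IsIrreducible.closure ⟨⟨_, x₀, ⟨h0, hx₀⟩, hne _ hx₀, rfl⟩,
      isPreirreducible_projImage hφ' hu' hL⟩
  refine ⟨by simpa using hirr Set.univ trivial (fun _ _ _ _ _ => trivial), le_antisymm ?_ ?_⟩
  · rw [← Nat.card_eq_fintype_card]
    exact topologicalKrullDim_closure_projImage_le hφ _
  -- the flag of coordinate subspaces through `x₀`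
  set n := Fintype.card σ
  let e : σ ≃ Fin n := Fintype.equivFin σ
  let L : Fin (n + 1) → Set (σ → K) := fun i => {x | ∀ j, (i : ℕ) ≤ e j → x j = x₀ j}
  refine le_topologicalKrullDim_of_chain
    (fun i => closure (projImage φ {x | x ∈ L i ∧ u x ≠ 0})) (fun _ => isClosed_closure)
    (fun i => hirr _ (fun _ _ => rfl) ?_)
    (fun i => closure_mono (projImage_mono φ fun x hx => hx.2)) (Fin.strictMono_iff_lt_succ.2 ?_)
  · intro x hx y hy t j hj
    have h := congrFun (AffineMap.lineMap_apply x y t) j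
    rw [h]
    simp [hx j hj, hy j hj]
  · intro i
    refine ⟨closure_mono (projImage_mono φ fun x hx => ⟨fun j hj => hx.1 j ?_, hx.2⟩),
      fun hle => ?_⟩
    · simp only [Fin.val_castSucc, Fin.val_succ] at hj ⊢
      omega
    -- move the `i`-th coordinate away from its value at `x₀`
    classical
    set j := e.symm i
    obtain ⟨d, f, h, hf, hh, H⟩ := hreg j
    obtain ⟨t, ht1, ht2⟩ := exists_lineMap_ne_zero (f := u) (g := fun x => x j - x₀ j)
      (x := x₀) (y := x₀ + Pi.single j 1) hu'
      ((lineFun K _).sub_mem (polyFun_le_lineFun K σ (coord_mem_polyFun j))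
        ((lineFun K _).algebraMap_mem (x₀ j))) hx₀ (by simp)
    set x := (AffineMap.lineMap x₀ (x₀ + Pi.single j 1) t : σ → K) with hx
    have hxL : x ∈ L i.succ := by
      intro k hk
      have hkj : k ≠ j := by
        rintro rfl
        simp [j] at hk
      have h := congrFun (AffineMap.lineMap_apply x₀ (x₀ + Pi.single j 1 : σ → K) t) k
      rw [hx, h]
      simp [hkj]
    have hmem := hle (subset_closure ⟨x, ⟨hxL, ht1⟩, hne _ ht1, rfl⟩)
    have hg : (f - MvPolynomial.C (x₀ j) * h).IsHomogeneous d := by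
      refine hf.sub ?_
      have := (MvPolynomial.isHomogeneous_C ((Fin r ⊕ Fin r) × (Fin r ⊕ Fin r)) (x₀ j)).mul hh
      rwa [zero_add] at this
    have hev : ∀ y (hy : u y ≠ 0), evalAt (φ y) (f - MvPolynomial.C (x₀ j) * h) =
        (y j - x₀ j) * evalAt (φ y) h := by
      intro y hy
      have := (H ⟨y, hy⟩).2
      simp only [evalAt, map_sub, map_mul, MvPolynomial.eval_C] at this ⊢
      rw [this]
      ring
    have h0 := mem_closure_iff_forall_homogeneous.1 hmem _ d hg (by
      rintro _ ⟨y, ⟨hyL, hyu⟩, hy, rfl⟩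
      rw [evalAt_rep_mk_eq_zero_iff hg, hev y hyu, hyL j (by simp [j]), sub_self, zero_mul])
    rw [evalAt_rep_mk_eq_zero_iff hg, hev x ht1] at h0
    exact mul_ne_zero ht2 (H ⟨x, ht1⟩).1 h0

end Zariski

/-! ### The symplectic group -/

section Symplectic

variable {K : Type*} [Field K] {l : Type*} [Fintype l] [DecidableEq l]

theorem fromBlocks_upper_mem {S : Matrix l l K} (hS : S.IsSymm) :
    Matrix.fromBlocks 1 S 0 1 ∈ Matrix.symplecticGroup l K := by
  rw [SymplecticGroup.fromBlocks_mem_iff]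
  simp [hS.eq]

theorem fromBlocks_lower_mem {S : Matrix l l K} (hS : S.IsSymm) :
    Matrix.fromBlocks 1 0 S 1 ∈ Matrix.symplecticGroup l K := by
  rw [SymplecticGroup.fromBlocks_mem_iff]
  simp [hS.eq]

theorem fromBlocks_levi_mem {g : Matrix l l K} (hg : g.det ≠ 0) :
    Matrix.fromBlocks g 0 0 g⁻¹ᵀ ∈ Matrix.symplecticGroup l K := by
  rw [SymplecticGroup.fromBlocks_mem_iff]
  refine ⟨by simp, by simp, ?_⟩
  rw [← Matrix.transpose_mul, Matrix.nonsing_inv_mul _ (isUnit_iff_ne_zero.2 hg)]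
  simp

/-- Every subspace of `K^l` has a complement spanned by coordinate vectors. -/
theorem exists_isCompl_span_coord (V : Submodule K (l → K)) :
    ∃ J : Finset l, Disjoint (Submodule.span K ((fun j => Pi.single j (1 : K)) '' (J : Set l))) V ∧
      Submodule.span K ((fun j => Pi.single j (1 : K)) '' (J : Set l)) ⊔ V = ⊤ := by
  obtain ⟨J, -, hJ⟩ := Finite.exists_le_maximal (α := Finset l) (p := fun J =>
    Disjoint (Submodule.span K ((fun j => Pi.single j (1 : K)) '' (J : Set l))) V) (a := ∅)
    (by simp)
  refine ⟨J, hJ.prop, ?_⟩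
  set W := Submodule.span K ((fun j => Pi.single j (1 : K)) '' (J : Set l))
  rw [eq_top_iff, ← (Pi.basisFun K l).span_eq, Submodule.span_le]
  rintro _ ⟨j, rfl⟩
  rw [Pi.basisFun_apply]
  by_contra hj
  have hj' : j ∉ J := fun h =>
    hj (Submodule.mem_sup_left (Submodule.subset_span ⟨j, h, rfl⟩))
  have h := hJ.le_of_ge (y := insert j J) ?_ (Finset.subset_insert j J)
  · exact hj' (h (Finset.mem_insert_self j J))
  · rw [Finset.coe_insert, Set.image_insert_eq, Submodule.span_insert]
    refine hJ.prop.disjoint_sup_left_of_disjoint_sup_right ?_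
    rw [disjoint_comm, Submodule.disjoint_span_singleton' (by simp)]
    exact hj

/-- A symplectic matrix acquires an invertible upper left block after multiplication by some
`u₊(S)`: take for `S` the projection onto a coordinate complement of the range of `A`. -/
theorem exists_isSymm_det_add_mul_ne_zero {A B C D : Matrix l l K}
    (hM : Matrix.fromBlocks A B C D ∈ Matrix.symplecticGroup l K) :
    ∃ S : Matrix l l K, S.IsSymm ∧ (A + S * C).det ≠ 0 := by
  obtain ⟨J, hJ, hJ'⟩ := exists_isCompl_span_coord (LinearMap.range A.mulVecLin)
  refine ⟨Matrix.diagonal fun j => if j ∈ J then 1 else 0, Matrix.isSymm_diagonal _, ?_⟩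
  set S : Matrix l l K := Matrix.diagonal fun j => if j ∈ J then 1 else 0 with hS
  by_contra hdet
  obtain ⟨v, hv0, hv⟩ := Matrix.exists_mulVec_eq_zero_iff.2 hdet
  apply hv0
  rw [Matrix.add_mulVec, ← Matrix.mulVec_mulVec] at hv
  have hSmem : ∀ w, S *ᵥ w ∈
      Submodule.span K ((fun j => Pi.single j (1 : K)) '' (J : Set l)) := by
    intro w
    have : S *ᵥ w = ∑ j ∈ J, w j • Pi.single j (1 : K) := by
      ext i
      simp [hS, Matrix.mulVec_diagonal, Finset.sum_apply, Pi.single_apply]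
    rw [this]
    exact Submodule.sum_mem _ fun j hj =>
      Submodule.smul_mem _ _ (Submodule.subset_span ⟨j, hj, rfl⟩)
  have hAv : A *ᵥ v = 0 := by
    refine (Submodule.disjoint_def.1 hJ) _ ?_ ⟨v, rfl⟩
    rw [eq_neg_of_add_eq_zero_left hv]
    exact Submodule.neg_mem _ (hSmem _)
  have hSC : S *ᵥ (C *ᵥ v) = 0 := by simpa [hAv] using hv
  -- `C v` is orthogonal to the range of `A` and to the complementary coordinate subspace
  have hCv : C *ᵥ v = 0 := by
    have horth : ∀ w, (C *ᵥ v) ⬝ᵥ w = 0 := by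
      intro w
      have hw : w ∈ Submodule.span K ((fun j => Pi.single j (1 : K)) '' (J : Set l)) ⊔
          LinearMap.range A.mulVecLin := hJ' ▸ Submodule.mem_top
      obtain ⟨w₁, h₁, _, ⟨w₂, rfl⟩, rfl⟩ := Submodule.mem_sup.1 hw
      rw [dotProduct_add]
      clear hw
      have e1 : (C *ᵥ v) ⬝ᵥ w₁ = 0 := by
        induction h₁ using Submodule.span_induction with
        | mem x hx =>
          obtain ⟨j, hj, rfl⟩ := hx
          have := congrFun hSC j
          simpa [hS, Matrix.mulVec_diagonal, Finset.mem_coe.1 hj] using this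
        | zero => simp
        | add x y _ _ hx hy => rw [dotProduct_add, hx, hy, add_zero]
        | smul c x _ hx => rw [dotProduct_smul, hx, smul_zero]
      have e2 : (C *ᵥ v) ⬝ᵥ A.mulVecLin w₂ = 0 := by
        have hAC := (SymplecticGroup.fromBlocks_mem_iff.1 hM).1
        rw [Matrix.mulVecLin_apply, Matrix.dotProduct_mulVec, ← Matrix.mulVec_transpose,
          Matrix.mulVec_mulVec, hAC, ← Matrix.mulVec_mulVec, hAv]
        simp
      rw [e1, e2, add_zero]
    exact dotProduct_eq_zero _ horth
  have hinj : Function.Injective (Matrix.fromBlocks A B C D).mulVec :=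
    Matrix.mulVec_injective_of_isUnit ((Matrix.isUnit_iff_isUnit_det _).2
      (SymplecticGroup.symplectic_det hM))
  have h := hinj (a₁ := Sum.elim v 0) (a₂ := 0) (by
    rw [Matrix.fromBlocks_mulVec, Matrix.mulVec_zero]
    ext (i | i) <;> simp [hAv, hCv])
  ext i
  simpa using congrFun h (Sum.inl i)

/-- The matrix `u₊(S) u₋(T) diag(g, g⁻ᵗ) u₊(R)`, where `u₊(S) = ((1, S), (0, 1))` and
`u₋(T) = ((1, 0), (T, 1))`. -/
noncomputable def bruhat (S T g R : Matrix l l K) : Matrix (l ⊕ l) (l ⊕ l) K :=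
  Matrix.fromBlocks 1 S 0 1 * Matrix.fromBlocks 1 0 T 1 * Matrix.fromBlocks g 0 0 g⁻¹ᵀ *
    Matrix.fromBlocks 1 R 0 1

theorem bruhat_mem {S T g R : Matrix l l K} (hS : S.IsSymm) (hT : T.IsSymm) (hg : g.det ≠ 0)
    (hR : R.IsSymm) : bruhat S T g R ∈ Matrix.symplecticGroup l K :=
  mul_mem (mul_mem (mul_mem (fromBlocks_upper_mem hS) (fromBlocks_lower_mem hT))
    (fromBlocks_levi_mem hg)) (fromBlocks_upper_mem hR)

/-- The factorization of a symplectic matrix whose upper left block is invertible, preceded by a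
multiplication by `u₊(S)` that makes this block invertible. -/
theorem exists_eq_bruhat {M : Matrix (l ⊕ l) (l ⊕ l) K} (hM : M ∈ Matrix.symplecticGroup l K) :
    ∃ S T g R : Matrix l l K, S.IsSymm ∧ T.IsSymm ∧ g.det ≠ 0 ∧ R.IsSymm ∧
      M = bruhat S T g R := by
  rw [← Matrix.fromBlocks_toBlocks M] at hM
  obtain ⟨S, hS, hdet⟩ := exists_isSymm_det_add_mul_ne_zero hM
  have hM' := mul_mem (fromBlocks_upper_mem hS) hM
  rw [Matrix.fromBlocks_multiply] at hM'
  simp only [one_mul, zero_mul, zero_add] at hM'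
  have hMM : M = Matrix.fromBlocks 1 (-S) 0 1 * Matrix.fromBlocks (M.toBlocks₁₁ + S * M.toBlocks₂₁)
      (M.toBlocks₁₂ + S * M.toBlocks₂₂) M.toBlocks₂₁ M.toBlocks₂₂ := by
    conv_lhs => rw [← Matrix.fromBlocks_toBlocks M]
    rw [Matrix.fromBlocks_multiply]
    simp
  set a := M.toBlocks₁₁ + S * M.toBlocks₂₁
  set b := M.toBlocks₁₂ + S * M.toBlocks₂₂
  set c := M.toBlocks₂₁
  set d := M.toBlocks₂₂
  obtain ⟨h1, -, h3⟩ := SymplecticGroup.fromBlocks_mem_iff.1 hM'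
  have hT := SymplecticGroup.transpose_mem hM'
  rw [Matrix.fromBlocks_transpose] at hT
  obtain ⟨h4, -, -⟩ := SymplecticGroup.fromBlocks_mem_iff.1 hT
  rw [Matrix.transpose_transpose, Matrix.transpose_transpose] at h4
  have ha := isUnit_iff_ne_zero.2 hdet
  have hai : a⁻¹ * a = 1 := Matrix.nonsing_inv_mul _ ha
  have hai' : a * a⁻¹ = 1 := Matrix.mul_nonsing_inv _ ha
  have hati : a⁻¹ᵀ * aᵀ = 1 := by rw [← Matrix.transpose_mul, hai', Matrix.transpose_one]
  have hati' : aᵀ * a⁻¹ᵀ = 1 := by rw [← Matrix.transpose_mul, hai, Matrix.transpose_one]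
  have hcT : cᵀ = aᵀ * c * a⁻¹ := by rw [h1, Matrix.mul_assoc, hai', Matrix.mul_one]
  have hbT : bᵀ = a⁻¹ * b * aᵀ := by rw [Matrix.mul_assoc, ← h4, ← Matrix.mul_assoc, hai,
    Matrix.one_mul]
  refine ⟨-S, c * a⁻¹, a, a⁻¹ * b, by rw [Matrix.IsSymm, Matrix.transpose_neg, hS.eq], ?_, hdet,
    ?_, ?_⟩
  · rw [Matrix.IsSymm, Matrix.transpose_mul, hcT, ← Matrix.mul_assoc, ← Matrix.mul_assoc, hati,
      Matrix.one_mul]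
  · rw [Matrix.IsSymm, Matrix.transpose_mul, hbT, Matrix.mul_assoc, hati', Matrix.mul_one]
  · have hd : d = c * a⁻¹ * b + a⁻¹ᵀ := by
      have h5 : aᵀ * d = aᵀ * (c * a⁻¹ * b) + 1 := by
        rw [← h3, hcT]
        simp only [Matrix.mul_assoc]
        abel
      calc d = a⁻¹ᵀ * (aᵀ * d) := by rw [← Matrix.mul_assoc, hati, Matrix.one_mul]
        _ = _ := by rw [h5, Matrix.mul_add, ← Matrix.mul_assoc, hati, Matrix.one_mul,
          Matrix.mul_one]
    rw [hMM, bruhat, Matrix.mul_assoc, Matrix.mul_assoc]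
    congr 1
    simp only [Matrix.fromBlocks_multiply, Matrix.mul_one, Matrix.one_mul, Matrix.mul_zero,
      Matrix.zero_mul, add_zero, zero_add]
    rw [Matrix.fromBlocks_inj]
    refine ⟨rfl, ?_, ?_, ?_⟩
    · rw [← Matrix.mul_assoc, hai', Matrix.one_mul]
    · rw [Matrix.mul_assoc, hai, Matrix.mul_one]
    · rw [← Matrix.mul_assoc (c * a⁻¹), Matrix.mul_assoc c, hai, Matrix.mul_one, hd,
        Matrix.mul_assoc]

/-- The matrix `det g • bruhat S T g R`, written without inverses. -/
def scaledBruhat (S T g R : Matrix l l K) : Matrix (l ⊕ l) (l ⊕ l) K :=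
  Matrix.fromBlocks 1 S 0 1 * Matrix.fromBlocks 1 0 T 1 *
    Matrix.fromBlocks (g.det • g) 0 0 g.adjugateᵀ * Matrix.fromBlocks 1 R 0 1

theorem scaledBruhat_eq {S T g R : Matrix l l K} (hg : g.det ≠ 0) :
    scaledBruhat S T g R = g.det • bruhat S T g R := by
  have h : g.adjugateᵀ = g.det • g⁻¹ᵀ := by
    rw [Matrix.inv_def, Ring.inverse_eq_inv', Matrix.transpose_smul, smul_smul,
      mul_inv_cancel₀ hg, one_smul]
  rw [scaledBruhat, bruhat, ← Matrix.smul_mul, ← Matrix.mul_smul, Matrix.fromBlocks_smul, h]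
  simp

end Symplectic

/-! ### Irreducibility of symplectic orbits -/

section Orbit

variable {K : Type*} [Field K] {r : ℕ}

theorem coe_symplectic_smul (M : Matrix.symplecticGroup (Fin r) K) (Z : SymMat K r) :
    ((M • Z : SymMat K r) : Matrix (Fin r ⊕ Fin r) (Fin r ⊕ Fin r) K) = M.1 * Z.1 * M.1ᵀ := rfl

theorem mul_mul_transpose_isSymm {m n : Type*} [Fintype n] (N : Matrix m n K) {Z : Matrix n n K}
    (hZ : Z.IsSymm) : (N * Z * Nᵀ).IsSymm := by
  rw [Matrix.IsSymm, Matrix.transpose_mul, Matrix.transpose_mul, hZ.eq, Matrix.transpose_transpose,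
    Matrix.mul_assoc]

theorem mk_eq_mk_of_coe_eq_smul {Z W : SymMat K r} (hZ : Z ≠ 0) (hW : W ≠ 0) (c : K)
    (h : Z.1 = c • W.1) : Projectivization.mk K Z hZ = Projectivization.mk K W hW := by
  rw [Projectivization.mk_eq_mk_iff']
  exact ⟨c, (Subtype.ext h).symm⟩

/-- Orbits of the symplectic group are irreducible, because the group is covered by the points
`u₊(S) u₋(T) diag(g, g⁻ᵗ) u₊(R)`, parametrized by an open subset of an affine space. -/
theorem isPreirreducible_orbit [Infinite K] (Z₀ : SymMat K r) (h₀ : Z₀ ≠ 0) :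
    IsPreirreducible (MulAction.orbit (Matrix.symplecticGroup (Fin r) K)
      (Projectivization.mk K Z₀ h₀)) := by
  let Mat := Matrix (Fin r) (Fin r) K
  let E := Mat × Mat × Mat × Mat
  let N : E → Matrix (Fin r ⊕ Fin r) (Fin r ⊕ Fin r) K := fun x =>
    scaledBruhat x.1 x.2.1 x.2.2.1 x.2.2.2
  let φ : E → SymMat K r := fun x => ⟨N x * Z₀.1 * (N x)ᵀ, mul_mul_transpose_isSymm _ Z₀.2⟩
  let L : Set E := {x | x.1.IsSymm ∧ x.2.1.IsSymm ∧ x.2.2.2.IsSymm}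
  have hlin : ∀ f : E →ₗ[K] Mat, MatMem (lineFun K E) f := fun f i j =>
    linearMap_mem_lineFun (Matrix.entryLinearMap K K i j ∘ₗ f)
  have hS : MatMem (lineFun K E) fun x => x.1 := hlin (LinearMap.fst K _ _)
  have hT : MatMem (lineFun K E) fun x => x.2.1 := hlin (LinearMap.fst K _ _ ∘ₗ LinearMap.snd K _ _)
  have hg : MatMem (lineFun K E) fun x => x.2.2.1 :=
    hlin (LinearMap.fst K _ _ ∘ₗ LinearMap.snd K _ _ ∘ₗ LinearMap.snd K _ _)
  have hR : MatMem (lineFun K E) fun x => x.2.2.2 :=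
    hlin (LinearMap.snd K _ _ ∘ₗ LinearMap.snd K _ _ ∘ₗ LinearMap.snd K _ _)
  have hN : MatMem (lineFun K E) N :=
    (((MatMem.const 1).fromBlocks hS (MatMem.const 0) (MatMem.const 1)).mul
      ((MatMem.const 1).fromBlocks (MatMem.const 0) hT (MatMem.const 1))).mul
      (MatMem.fromBlocks (MatMem.smul hg.det hg) (MatMem.const 0) (MatMem.const 0)
        hg.adjugate.transpose) |>.mul
      ((MatMem.const 1).fromBlocks hR (MatMem.const 0) (MatMem.const 1))
  have hφ : MatMem (lineFun K E) fun x => (φ x).1 := (hN.mul (MatMem.const Z₀.1)).mul hN.transpose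
  have hL : ∀ x ∈ L, ∀ y ∈ L, ∀ t : K, AffineMap.lineMap x y t ∈ L := by
    rintro x ⟨hx1, hx2, hx3⟩ y ⟨hy1, hy2, hy3⟩ t
    rw [AffineMap.lineMap_apply]
    exact ⟨((hy1.sub hx1).smul t).add hx1, ((hy2.sub hx2).smul t).add hx2,
      ((hy3.sub hx3).smul t).add hx3⟩
  have key := isPreirreducible_projImage hφ hg.det hL
  convert key using 1
  have hφ' : ∀ (x : E) (M : Matrix.symplecticGroup (Fin r) K), x.2.2.1.det ≠ 0 →
      M.1 = bruhat x.1 x.2.1 x.2.2.1 x.2.2.2 →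
      (φ x).1 = (x.2.2.1.det * x.2.2.1.det) • (M • Z₀).1 := by
    intro x M hd hM
    rw [coe_symplectic_smul, hM]
    change N x * Z₀.1 * (N x)ᵀ = _
    simp only [N, scaledBruhat_eq hd, Matrix.transpose_smul, Matrix.smul_mul, Matrix.mul_smul,
      smul_smul]
  have hne : ∀ M : Matrix.symplecticGroup (Fin r) K, M • Z₀ ≠ 0 := fun M =>
    (smul_ne_zero_iff_ne M).2 h₀
  ext y
  constructor
  · rintro ⟨M, rfl⟩
    obtain ⟨S, T, g, R, hS, hT, hg, hR, hM⟩ := exists_eq_bruhat M.2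
    have h1 := hφ' (S, T, g, R) M hg hM
    have h2 : φ (S, T, g, R) ≠ 0 := by
      intro h
      rw [h] at h1
      exact smul_ne_zero (mul_ne_zero hg hg) (hne M) (Subtype.ext h1.symm)
    refine ⟨(S, T, g, R), ⟨⟨hS, hT, hR⟩, hg⟩, h2, ?_⟩
    change M • Projectivization.mk K Z₀ h₀ = _
    rw [Projectivization.smul_mk]
    exact (mk_eq_mk_of_coe_eq_smul _ _ _ h1).symm
  · rintro ⟨x, ⟨hx, hd⟩, hne', rfl⟩
    let M : Matrix.symplecticGroup (Fin r) K := ⟨_, bruhat_mem hx.1 hx.2.1 hd hx.2.2⟩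
    refine ⟨M, ?_⟩
    change M • Projectivization.mk K Z₀ h₀ = _
    rw [Projectivization.smul_mk]
    exact (mk_eq_mk_of_coe_eq_smul _ _ _ (hφ' x M hd rfl)).symm

/-- If the points of an orbit at which a homogeneous polynomial does not vanish lie in `T`, and
there is such a point, then the orbit is contained in the closure of `T`. -/
theorem orbit_subset_closure [Infinite K] {Z₀ : SymMat K r} (h₀ : Z₀ ≠ 0) {T : Set (PSym K r)}
    {p : EntryPoly K r} {d : ℕ} (hp : p.IsHomogeneous d) (hp₀ : evalAt Z₀ p ≠ 0)
    (hT : ∀ (M : Matrix.symplecticGroup (Fin r) K) (h : M • Z₀ ≠ 0), evalAt (M • Z₀) p ≠ 0 →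
      Projectivization.mk K (M • Z₀) h ∈ T) :
    MulAction.orbit (Matrix.symplecticGroup (Fin r) K) (Projectivization.mk K Z₀ h₀) ⊆
      closure T := by
  have hcl : IsClosed (projZeros {p} : Set (PSym K r)) := by
    rw [isClosed_iff_isAlgebraic]
    exact ⟨{p}, fun q hq => ⟨d, by rwa [Set.mem_singleton_iff.1 hq]⟩, rfl⟩
  have hmem : ∀ (Z : SymMat K r) (hZ : Z ≠ 0), Projectivization.mk K Z hZ ∈ (projZeros {p})ᶜ ↔
      evalAt Z p ≠ 0 := fun Z hZ => by
    rw [Set.mem_compl_iff, mk_mem_projZeros (fun q hq => ⟨d, by rwa [Set.mem_singleton_iff.1 hq]⟩)]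
    simp
  refine (subset_closure_inter_of_isPreirreducible_of_isOpen (isPreirreducible_orbit Z₀ h₀)
    hcl.isOpen_compl ⟨_, MulAction.mem_orbit_self _, (hmem _ _).2 hp₀⟩).trans (closure_mono ?_)
  rintro _ ⟨⟨M, rfl⟩, hM⟩
  change M • Projectivization.mk K Z₀ h₀ ∈ _ at hM
  change M • Projectivization.mk K Z₀ h₀ ∈ _
  rw [Projectivization.smul_mk] at hM ⊢
  exact hT M _ ((hmem _ _).1 hM)

theorem isHomogeneous_det_X {n : ℕ} (a : Fin n → Fin r ⊕ Fin r) :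
    (Matrix.of fun i j => (MvPolynomial.X (a i, a j) : EntryPoly K r)).det.IsHomogeneous n := by
  rw [Matrix.det_apply']
  refine MvPolynomial.IsHomogeneous.sum _ _ _ fun s _ => ?_
  have h := (MvPolynomial.isHomogeneous_C ((Fin r ⊕ Fin r) × (Fin r ⊕ Fin r))
    ((Equiv.Perm.sign s : ℤ) : K)).mul
    (MvPolynomial.IsHomogeneous.prod Finset.univ
      (fun i => (MvPolynomial.X (a (s i), a i) : EntryPoly K r)) (fun _ => 1)
      fun i _ => MvPolynomial.isHomogeneous_X _ _)
  simpa using h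

theorem evalAt_det_X {n : ℕ} (a : Fin n → Fin r ⊕ Fin r) (Z : SymMat K r) :
    evalAt Z (Matrix.of fun i j => (MvPolynomial.X (a i, a j) : EntryPoly K r)).det =
      (Z.1.submatrix a a).det := by
  rw [evalAt, RingHom.map_det]
  congr 1
  ext i j
  simp

end Orbit

/-! ### Symmetric matrices over an algebraically closed field -/

/-- A nondegenerate symmetric matrix over an algebraically closed field is of the form `g gᵗ`. -/
theorem exists_eq_mul_transpose {K : Type*} [Field K] [IsAlgClosed K] [CharZero K] {n : ℕ}
    {D : Matrix (Fin n) (Fin n) K} (hD : D.IsSymm) (hdet : D.det ≠ 0) :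
    ∃ g : Matrix (Fin n) (Fin n) K, g.det ≠ 0 ∧ D = g * gᵀ := by
  let _ : Invertible (2 : K) := invertibleOfNonzero two_ne_zero
  have hassoc : ∀ A : Matrix (Fin n) (Fin n) K, A.IsSymm →
      QuadraticMap.associated (R := K) A.toQuadraticForm' = Matrix.toLinearMap₂' K A := by
    intro A hA
    apply QuadraticMap.associated_left_inverse (S := K)
    intro x y
    simp only [Matrix.toLinearMap₂'_apply']
    rw [Matrix.dotProduct_mulVec, ← Matrix.mulVec_transpose, hA.eq, dotProduct_comm]
  have hsep : (QuadraticMap.associated (R := K) D.toQuadraticForm').SeparatingLeft := by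
    rw [hassoc D hD]
    exact (Matrix.separatingLeft_toLinearMap₂'_iff).2 (Matrix.nondegenerate_of_det_ne_zero hdet).1
  obtain ⟨e⟩ := D.toQuadraticForm'.equivalent_weightedSumSquares_of_isAlgClosed hsep
  have hfin : n = Module.finrank K (Fin n → K) := by simp
  set G : Matrix (Fin (Module.finrank K (Fin n → K))) (Fin n) K :=
    LinearMap.toMatrix' (e.toLinearEquiv : (Fin n → K) →ₗ[K] _) with hG
  have hGe : ∀ v, G *ᵥ v = e v := fun v => by
    rw [hG, LinearMap.toMatrix'_mulVec]
    rfl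
  have hsymm : (Gᵀ * G).IsSymm := by
    rw [Matrix.IsSymm, Matrix.transpose_mul, Matrix.transpose_transpose]
  have hQ : (Gᵀ * G).toQuadraticForm' = D.toQuadraticForm' := by
    ext v
    rw [← e.map_app v, QuadraticMap.weightedSumSquares_apply, ← hGe]
    change Matrix.toLinearMap₂' K (Gᵀ * G) v v = _
    rw [Matrix.toLinearMap₂'_apply', ← Matrix.mulVec_mulVec, Matrix.dotProduct_mulVec,
      ← Matrix.mulVec_transpose, Matrix.transpose_transpose]
    simp [dotProduct]
  have hDG : D = Gᵀ * G := by
    have h := hassoc D hD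
    rw [← hQ, hassoc _ hsymm] at h
    exact ((Matrix.toLinearMap₂' K).injective h).symm
  have hDg : D = (G.submatrix (finCongr hfin) id)ᵀ * (G.submatrix (finCongr hfin) id)ᵀᵀ := by
    rw [Matrix.transpose_transpose, Matrix.transpose_submatrix, Matrix.submatrix_mul_equiv, hDG]
    simp
  refine ⟨(G.submatrix (finCongr hfin) id)ᵀ, fun h => hdet ?_, hDg⟩
  rw [hDg, Matrix.det_mul, h, zero_mul]

/-! ### Coordinates on symmetric matrices -/

section SymmetricCoordinates

variable {K : Type*} {n : ℕ}

/-- The symmetric matrix with prescribed entries, indexed by unordered pairs of indices. -/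
def symOf (f : Sym2 (Fin n) → K) : Matrix (Fin n) (Fin n) K := Matrix.of fun i j => f s(i, j)

theorem symOf_isSymm (f : Sym2 (Fin n) → K) : (symOf f).IsSymm :=
  Matrix.IsSymm.ext fun i j => by simp [symOf, Sym2.eq_swap]

/-- The entries of a symmetric matrix, indexed by unordered pairs of indices. -/
def symCoords {A : Matrix (Fin n) (Fin n) K} (hA : A.IsSymm) : Sym2 (Fin n) → K :=
  Sym2.lift ⟨fun i j => A i j, fun i j => hA.apply j i⟩

theorem symOf_symCoords {A : Matrix (Fin n) (Fin n) K} (hA : A.IsSymm) :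
    symOf (symCoords hA) = A := by
  ext i j
  simp [symOf, symCoords]

variable [Field K]

/-- The index set of the entries of a symmetric matrix with one diagonal entry removed. -/
abbrev OffPair (i₀ : Fin n) : Type := {e : Sym2 (Fin n) // e ≠ s(i₀, i₀)}

/-- Entries of a symmetric matrix whose diagonal entry at `i₀` is normalized to `1`. -/
def extendOne (i₀ : Fin n) (x : OffPair i₀ → K) : Sym2 (Fin n) → K :=
  fun e => if h : e = s(i₀, i₀) then 1 else x ⟨e, h⟩

theorem symOf_extendOne_self (i₀ : Fin n) (x : OffPair i₀ → K) :
    symOf (extendOne i₀ x) i₀ i₀ = 1 := by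
  simp [symOf, extendOne]

theorem symOf_extendOne_symCoords {A : Matrix (Fin n) (Fin n) K} (hA : A.IsSymm) {i₀ : Fin n}
    (h : A i₀ i₀ = 1) : symOf (extendOne i₀ fun e => symCoords hA e.1) = A := by
  conv_rhs => rw [← symOf_symCoords hA]
  congr 1
  ext e
  by_cases he : e = s(i₀, i₀)
  · subst he
    simp [extendOne, symCoords, h]
  · simp [extendOne, he]

theorem symOf_extendOne_one (i₀ : Fin n) :
    symOf (extendOne i₀ fun e => symCoords (Matrix.isSymm_one (α := K)) e.1) = 1 :=
  symOf_extendOne_symCoords _ (Matrix.one_apply_eq i₀)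

theorem card_offPair (i₀ : Fin n) : Fintype.card (OffPair i₀) = n * (n + 1) / 2 - 1 := by
  rw [Fintype.card_subtype_compl (fun e => e = s(i₀, i₀)), Fintype.card_subtype_eq, Sym2.card,
    Fintype.card_fin, Nat.choose_two_right, Nat.add_sub_cancel, mul_comm]

theorem card_sym2_fin (n : ℕ) : Fintype.card (Sym2 (Fin n)) = n * (n + 1) / 2 := by
  rw [Sym2.card, Fintype.card_fin, Nat.choose_two_right, Nat.add_sub_cancel, mul_comm]

theorem MatMem.symOf {X : Type*} {A : Subalgebra K (X → K)} {f : X → Sym2 (Fin n) → K}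
    (hf : ∀ e, (fun x => f x e) ∈ A) : MatMem A fun x => symOf (f x) :=
  fun i j => hf s(i, j)

theorem extendOne_mem {X : Type*} {A : Subalgebra K (X → K)} {i₀ : Fin n} {f : X → OffPair i₀ → K}
    (hf : ∀ e, (fun x => f x e) ∈ A) (e : Sym2 (Fin n)) : (fun x => extendOne i₀ (f x) e) ∈ A := by
  by_cases he : e = s(i₀, i₀)
  · simp only [extendOne, he, dite_true]
    exact A.one_mem
  · simpa [extendOne, he] using hf ⟨e, he⟩

theorem coord_mem_of_matMem_symOf {X : Type*} {A : Subalgebra K (X → K)}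
    {f : X → Sym2 (Fin n) → K} (h : MatMem A fun x => SymplecticQuadrics.symOf (f x))
    (e : Sym2 (Fin n)) : (fun x => f x e) ∈ A := by
  induction e using Sym2.ind with
  | _ i j => exact h i j

theorem coord_mem_of_matMem_extendOne {X : Type*} {A : Subalgebra K (X → K)} {i₀ : Fin n}
    {f : X → OffPair i₀ → K}
    (h : MatMem A fun x => SymplecticQuadrics.symOf (extendOne i₀ (f x))) (e : OffPair i₀) :
    (fun x => f x e) ∈ A := by
  have := coord_mem_of_matMem_symOf h e.1
  simpa [extendOne, e.2] using this

end SymmetricCoordinates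

theorem lower_mul_fromBlocks_mul {K l : Type*} [Field K] [Fintype l] [DecidableEq l]
    (A C : Matrix l l K) {S : Matrix l l K} (hS : S.IsSymm) :
    Matrix.fromBlocks 1 0 S 1 * Matrix.fromBlocks A 0 0 C * (Matrix.fromBlocks 1 0 S 1)ᵀ =
      Matrix.fromBlocks A (A * S) (S * A) (S * A * S + C) := by
  simp [Matrix.fromBlocks_transpose, Matrix.fromBlocks_multiply, hS.eq]

/-! ### The open cell of the orbit of the identity -/

section IdentityOrbit

variable {K : Type*} [Field K] {r : ℕ} (i₀ : Fin r)

/-- The index set of the coordinates `(A, S, μ)` on the open cell of the orbit of the identity: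
`A` and `S` are symmetric, with `A i₀ i₀ = 1`. -/
abbrev IdIndex : Type := OffPair i₀ ⊕ Sym2 (Fin r) ⊕ Unit

/-- The symmetric matrix `A` of the coordinates `(A, S, μ)`. -/
def idA (x : IdIndex i₀ → K) : Matrix (Fin r) (Fin r) K := symOf (extendOne i₀ fun e => x (.inl e))

/-- The symmetric matrix `S` of the coordinates `(A, S, μ)`. -/
def idS (x : IdIndex i₀ → K) : Matrix (Fin r) (Fin r) K := symOf fun e => x (.inr (.inl e))

/-- The scalar `μ` of the coordinates `(A, S, μ)`. -/
def idMu (x : IdIndex i₀ → K) : K := x (.inr (.inr ()))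

theorem idA_isSymm (x : IdIndex i₀ → K) : (idA i₀ x).IsSymm := symOf_isSymm _

theorem idS_isSymm {K : Type*} (x : IdIndex i₀ → K) : (idS i₀ x).IsSymm := symOf_isSymm _

/-- The parametrization `det A • ((A, AS), (SA, SAS + μA⁻¹))` of the open cell of the orbit of the
identity. -/
def idParam (x : IdIndex i₀ → K) : SymMat K r :=
  ⟨Matrix.fromBlocks 1 0 (idS i₀ x) 1 *
    Matrix.fromBlocks ((idA i₀ x).det • idA i₀ x) 0 0 (idMu i₀ x • (idA i₀ x).adjugate) *
    (Matrix.fromBlocks 1 0 (idS i₀ x) 1)ᵀ, mul_mul_transpose_isSymm _ (by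
      rw [Matrix.isSymm_fromBlocks_iff]
      refine ⟨(idA_isSymm i₀ x).smul _, by simp, by simp, Matrix.IsSymm.smul ?_ _⟩
      rw [Matrix.IsSymm, Matrix.adjugate_transpose, (idA_isSymm i₀ x).eq])⟩

theorem idParam_eq (x : IdIndex i₀ → K) (h : (idA i₀ x).det ≠ 0) :
    (idParam i₀ x).1 = (idA i₀ x).det • Matrix.fromBlocks (idA i₀ x) (idA i₀ x * idS i₀ x)
      (idS i₀ x * idA i₀ x) (idS i₀ x * idA i₀ x * idS i₀ x + idMu i₀ x • (idA i₀ x)⁻¹) := by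
  have hadj : (idA i₀ x).adjugate = (idA i₀ x).det • (idA i₀ x)⁻¹ := by
    rw [Matrix.inv_def, Ring.inverse_eq_inv', smul_smul, mul_inv_cancel₀ h, one_smul]
  have hval : (idParam i₀ x).1 = Matrix.fromBlocks 1 0 (idS i₀ x) 1 *
    Matrix.fromBlocks ((idA i₀ x).det • idA i₀ x) 0 0 (idMu i₀ x • (idA i₀ x).adjugate) *
    (Matrix.fromBlocks 1 0 (idS i₀ x) 1)ᵀ := rfl
  rw [hval, lower_mul_fromBlocks_mul _ _ (idS_isSymm i₀ x), hadj, Matrix.fromBlocks_smul]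
  simp only [Matrix.smul_mul, Matrix.mul_smul, smul_add, smul_comm (idMu i₀ x)]

theorem matMem_idParam :
    MatMem (polyFun K (IdIndex i₀)) fun x => (idParam i₀ x).1 := by
  have hA : MatMem (polyFun K (IdIndex i₀)) (idA i₀) :=
    MatMem.symOf (extendOne_mem fun e => coord_mem_polyFun _)
  have hS : MatMem (polyFun K (IdIndex i₀)) (idS i₀) := MatMem.symOf fun e => coord_mem_polyFun _
  have hL : MatMem (polyFun K (IdIndex i₀)) fun x =>
      Matrix.fromBlocks (1 : Matrix (Fin r) (Fin r) K) (0 : Matrix (Fin r) (Fin r) K) (idS i₀ x)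
        (1 : Matrix (Fin r) (Fin r) K) :=
    (MatMem.const 1).fromBlocks (MatMem.const 0) hS (MatMem.const 1)
  exact (hL.mul ((MatMem.smul hA.det hA).fromBlocks (MatMem.const 0) (MatMem.const 0)
    (MatMem.smul (coord_mem_polyFun _) hA.adjugate))).mul hL.transpose

theorem idDenom_mem : (fun x => (idA i₀ x).det * idMu i₀ x) ∈ polyFun K (IdIndex i₀) :=
  (polyFun K _).mul_mem (MatMem.det (MatMem.symOf (extendOne_mem fun _ => coord_mem_polyFun _)))
    (coord_mem_polyFun _)

theorem idParam_apply (x : IdIndex i₀ → K) (h : (idA i₀ x).det * idMu i₀ x ≠ 0) :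
    (idParam i₀ x).1 (.inl i₀) (.inl i₀) = (idA i₀ x).det := by
  rw [idParam_eq i₀ x (left_ne_zero_of_mul h)]
  simp [idA, symOf_extendOne_self]

theorem idParam_ne_zero (x : IdIndex i₀ → K) (h : (idA i₀ x).det * idMu i₀ x ≠ 0) :
    idParam i₀ x ≠ 0 := by
  intro h0
  have := idParam_apply i₀ x h
  rw [h0] at this
  exact left_ne_zero_of_mul h this.symm

/-- The coordinates `(A, S, μ)` are regular on the cell. Dividing `idParam` by its entry at `i₀`
removes the factor `det A`; then `S = A⁻¹ (AS)`, and `μ` is read off from the lower right block. -/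
theorem idCoord_mem_regFun (i : IdIndex i₀) :
    (fun x : {x : IdIndex i₀ → K | (idA i₀ x).det * idMu i₀ x ≠ 0} => x.1 i) ∈
      regFun (idParam i₀) {x | (idA i₀ x).det * idMu i₀ x ≠ 0} := by
  set U := {x : IdIndex i₀ → K | (idA i₀ x).det * idMu i₀ x ≠ 0}
  have hZ := matMem_regFun_smul (φ := idParam i₀) (U := U) (.inl i₀) (.inl i₀) fun x hx => by
    rw [idParam_apply i₀ x hx]
    exact left_ne_zero_of_mul hx
  have hZ' : MatMem (regFun (idParam i₀) U) fun x : U =>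
      Matrix.fromBlocks (idA i₀ x.1) (idA i₀ x.1 * idS i₀ x.1)
      (idS i₀ x.1 * idA i₀ x.1)
      (idS i₀ x.1 * idA i₀ x.1 * idS i₀ x.1 + idMu i₀ x.1 • (idA i₀ x.1)⁻¹) := by
    convert hZ using 2 with x
    rw [idParam_apply i₀ x.1 x.2, idParam_eq i₀ x.1 (left_ne_zero_of_mul x.2), smul_smul,
      inv_mul_cancel₀ (left_ne_zero_of_mul x.2), one_smul]
  have hdet : ∀ x : U, (idA i₀ x.1).det ≠ 0 := fun x => left_ne_zero_of_mul x.2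
  have hinv : ∀ x : U, (idA i₀ x.1)⁻¹ * idA i₀ x.1 = 1 := fun x =>
    Matrix.nonsing_inv_mul _ (isUnit_iff_ne_zero.2 (hdet x))
  have hA : MatMem (regFun (idParam i₀) U) fun x : U => idA i₀ x.1 := hZ'.submatrix .inl .inl
  have hAS : MatMem (regFun (idParam i₀) U) fun x : U => idA i₀ x.1 * idS i₀ x.1 :=
    hZ'.submatrix .inl .inr
  have hS : MatMem (regFun (idParam i₀) U) fun x : U => idS i₀ x.1 := by
    convert (hA.inv_regFun hdet).mul hAS using 2 with x
    rw [← Matrix.mul_assoc, hinv, Matrix.one_mul]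
  have hμ : MatMem (regFun (idParam i₀) U) fun x : U =>
      idMu i₀ x.1 • (1 : Matrix (Fin r) (Fin r) K) := by
    convert ((hZ'.submatrix .inr .inr).sub ((hS.mul hA).mul hS)).mul hA using 2 with x
    have : (Matrix.fromBlocks (idA i₀ x.1) (idA i₀ x.1 * idS i₀ x.1)
      (idS i₀ x.1 * idA i₀ x.1)
      (idS i₀ x.1 * idA i₀ x.1 * idS i₀ x.1 + idMu i₀ x.1 • (idA i₀ x.1)⁻¹)).submatrix
        Sum.inr Sum.inr =
        idS i₀ x.1 * idA i₀ x.1 * idS i₀ x.1 + idMu i₀ x.1 • (idA i₀ x.1)⁻¹ := rfl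
    rw [this, add_sub_cancel_left, Matrix.smul_mul, hinv]
  rcases i with e | e | e
  · exact coord_mem_of_matMem_extendOne (f := fun (x : U) e => x.1 (.inl e)) hA e
  · exact coord_mem_of_matMem_symOf (f := fun (x : U) e => x.1 (.inr (.inl e))) hS e
  · simpa [idMu] using hμ i₀ i₀

theorem card_idIndex : Fintype.card (IdIndex i₀) = r * (r + 1) := by
  rw [Fintype.card_sum, Fintype.card_sum, card_offPair, card_sym2_fin, Fintype.card_unit]
  have h := Nat.div_mul_cancel (Nat.even_mul_succ_self r).two_dvd
  have hr : 0 < r := i₀.pos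
  have : 0 < r * (r + 1) := by positivity
  omega

/-- If `c² = μ` and `A = c g gᵗ`, then `u₋(S) diag(g, g⁻ᵗ)` moves the identity to the point with
coordinates `(A, S, μ)`. -/
theorem projImage_idParam_subset [IsAlgClosed K] [CharZero K] (h₀ : idMat K r ≠ 0) :
    projImage (idParam i₀) {x | (idA i₀ x).det * idMu i₀ x ≠ 0} ⊆
      MulAction.orbit (Matrix.symplecticGroup (Fin r) K)
        (Projectivization.mk K (idMat K r) h₀) := by
  rintro _ ⟨x, hx, hne, rfl⟩
  have hdet : (idA i₀ x).det ≠ 0 := left_ne_zero_of_mul hx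
  have hμ : idMu i₀ x ≠ 0 := right_ne_zero_of_mul hx
  obtain ⟨c, hc⟩ := IsAlgClosed.exists_pow_nat_eq (idMu i₀ x) two_pos
  have hc0 : c ≠ 0 := by
    rintro rfl
    exact hμ (by simpa using hc.symm)
  obtain ⟨g, hg, hD⟩ := exists_eq_mul_transpose ((idA_isSymm i₀ x).smul c⁻¹)
    (by rw [Matrix.det_smul]; exact mul_ne_zero (pow_ne_zero _ (inv_ne_zero hc0)) hdet)
  have hA : idA i₀ x = c • (g * gᵀ) := by rw [← hD, smul_smul, mul_inv_cancel₀ hc0, one_smul]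
  have hAinv : idMu i₀ x • (idA i₀ x)⁻¹ = c • (g⁻¹ᵀ * g⁻¹) := by
    have h1 : (idA i₀ x)⁻¹ = c⁻¹ • (g⁻¹ᵀ * g⁻¹) := by
      apply Matrix.inv_eq_left_inv
      have hgu := isUnit_iff_ne_zero.2 hg
      rw [hA, Matrix.smul_mul, Matrix.mul_smul, smul_smul, inv_mul_cancel₀ hc0, one_smul,
        Matrix.mul_assoc, ← Matrix.mul_assoc g⁻¹, Matrix.nonsing_inv_mul _ hgu, Matrix.one_mul,
        ← Matrix.transpose_mul, Matrix.mul_nonsing_inv _ hgu, Matrix.transpose_one]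
    rw [h1, smul_smul, ← hc, pow_two, mul_assoc, mul_inv_cancel₀ hc0, mul_one]
  let M : Matrix.symplecticGroup (Fin r) K :=
    ⟨_, mul_mem (fromBlocks_lower_mem (idS_isSymm i₀ x)) (fromBlocks_levi_mem hg)⟩
  refine ⟨M, ?_⟩
  change M • Projectivization.mk K (idMat K r) h₀ = _
  rw [Projectivization.smul_mk]
  refine (mk_eq_mk_of_coe_eq_smul _ _ ((idA i₀ x).det * c) ?_).symm
  rw [coe_symplectic_smul, idParam_eq i₀ x hdet, hAinv,
    ← lower_mul_fromBlocks_mul _ _ (idS_isSymm i₀ x), ← smul_smul]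
  congr 1
  have h2 : Matrix.fromBlocks (idA i₀ x) 0 0 (c • (g⁻¹ᵀ * g⁻¹)) =
      c • (Matrix.fromBlocks g 0 0 g⁻¹ᵀ * (idMat K r).1 * (Matrix.fromBlocks g 0 0 g⁻¹ᵀ)ᵀ) := by
    simp only [idMat, Matrix.mul_one, Matrix.fromBlocks_transpose, Matrix.fromBlocks_multiply,
      Matrix.fromBlocks_smul, hA]
    simp
  rw [h2]
  simp only [M, Matrix.transpose_mul, Matrix.mul_assoc, Matrix.smul_mul, Matrix.mul_smul]

/-- The cell is dense in the orbit of the identity: it contains all points at which neither the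
diagonal entry at `i₀` nor the determinant of the upper left block vanishes. -/
theorem orbit_subset_closure_projImage_idParam [Infinite K] (h₀ : idMat K r ≠ 0) :
    MulAction.orbit (Matrix.symplecticGroup (Fin r) K) (Projectivization.mk K (idMat K r) h₀) ⊆
      closure (projImage (idParam i₀) {x | (idA i₀ x).det * idMu i₀ x ≠ 0}) := by
  have hev : ∀ Z : SymMat K r, evalAt Z (MvPolynomial.X (.inl i₀, .inl i₀) *
      (Matrix.of fun i j : Fin r => (MvPolynomial.X (.inl i, .inl j) : EntryPoly K r)).det) =
      Z.1 (.inl i₀) (.inl i₀) * Z.1.toBlocks₁₁.det := fun Z => by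
    have h1 := evalAt_det_X (fun i : Fin r => Sum.inl i) Z
    rw [show Z.1.toBlocks₁₁ = Z.1.submatrix (fun i => Sum.inl i) fun i => Sum.inl i from rfl, ← h1]
    simp only [evalAt, map_mul, MvPolynomial.eval_X]
  refine orbit_subset_closure h₀ ((MvPolynomial.isHomogeneous_X K (Sum.inl i₀, Sum.inl i₀)).mul
    (isHomogeneous_det_X fun i => Sum.inl i)) ?_ ?_
  · rw [hev]
    have h1 : (idMat K r).1.toBlocks₁₁ = 1 := by
      ext i j
      simp [idMat, Matrix.toBlocks₁₁, Matrix.one_apply]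
    rw [h1]
    simp [idMat]
  · intro M hne hM
    rw [hev] at hM
    have ha := left_ne_zero_of_mul hM
    have hdet := right_ne_zero_of_mul hM
    have hZ : (M • idMat K r).1 ∈ Matrix.symplecticGroup (Fin r) K := by
      rw [coe_symplectic_smul]
      simpa [idMat] using mul_mem M.2 (SymplecticGroup.transpose_mem M.2)
    have hsymm : (M • idMat K r).1.IsSymm := (M • idMat K r).2
    set Z := M • idMat K r
    rw [← Matrix.fromBlocks_toBlocks Z.1] at hZ hsymm
    set A := Z.1.toBlocks₁₁
    set B := Z.1.toBlocks₁₂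
    obtain ⟨hAs, hB, -, -⟩ := Matrix.isSymm_fromBlocks_iff.1 hsymm
    rw [← hB] at hZ
    set C := Z.1.toBlocks₂₂
    obtain ⟨h1, -, h3⟩ := SymplecticGroup.fromBlocks_mem_iff.1 hZ
    rw [Matrix.transpose_transpose, hAs.eq] at h1 h3
    have hu := isUnit_iff_ne_zero.2 hdet
    have hi : A⁻¹ * A = 1 := Matrix.nonsing_inv_mul _ hu
    have hi' : A * A⁻¹ = 1 := Matrix.mul_nonsing_inv _ hu
    have hAis : A⁻¹ᵀ = A⁻¹ := by rw [Matrix.transpose_nonsing_inv, hAs.eq]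
    set S := A⁻¹ * B with hS
    have hAS : A * S = B := by rw [hS, ← Matrix.mul_assoc, hi', Matrix.one_mul]
    have hSs : S.IsSymm := by
      rw [Matrix.IsSymm, hS, Matrix.transpose_mul, hAis]
      calc Bᵀ * A⁻¹ = A⁻¹ * (A * Bᵀ) * A⁻¹ := by rw [← Matrix.mul_assoc, hi, Matrix.one_mul]
        _ = A⁻¹ * B := by rw [h1, Matrix.mul_assoc, Matrix.mul_assoc, hi', Matrix.mul_one]
    have hSA : S * A = Bᵀ := by rw [← hAS, Matrix.transpose_mul, hSs.eq, hAs.eq]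
    have hC : C = S * A * S + A⁻¹ := by
      have h4 : A * C = B * B + 1 := by rw [← h3]; abel
      calc C = A⁻¹ * (A * C) := by rw [← Matrix.mul_assoc, hi, Matrix.one_mul]
        _ = _ := by rw [h4, Matrix.mul_assoc, hAS, Matrix.mul_add, hS, Matrix.mul_assoc,
          Matrix.mul_one]
    clear_value S
    set a := Z.1 (.inl i₀) (.inl i₀)
    have hA's : (a⁻¹ • A).IsSymm := hAs.smul _
    -- the coordinates of the point
    let x : IdIndex i₀ → K := Sum.elim (fun e => symCoords hA's e.1)
      (Sum.elim (symCoords hSs) fun _ => a⁻¹ * a⁻¹)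
    have hxA : idA i₀ x = a⁻¹ • A := symOf_extendOne_symCoords hA's (inv_mul_cancel₀ ha)
    have hxS : idS i₀ x = S := symOf_symCoords hSs
    have hxμ : idMu i₀ x = a⁻¹ * a⁻¹ := rfl
    have hxdet : (idA i₀ x).det ≠ 0 := by
      rw [hxA, Matrix.det_smul]
      exact mul_ne_zero (pow_ne_zero _ (inv_ne_zero ha)) hdet
    have hxu : (idA i₀ x).det * idMu i₀ x ≠ 0 :=
      mul_ne_zero hxdet (mul_ne_zero (inv_ne_zero ha) (inv_ne_zero ha))
    refine ⟨x, hxu, idParam_ne_zero i₀ x hxu, ?_⟩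
    refine (mk_eq_mk_of_coe_eq_smul _ _ ((idA i₀ x).det * a⁻¹) ?_).symm
    have hinv : (a⁻¹ • A)⁻¹ = a • A⁻¹ := by
      apply Matrix.inv_eq_left_inv
      rw [Matrix.smul_mul, Matrix.mul_smul, smul_smul, mul_inv_cancel₀ ha, one_smul, hi]
    rw [idParam_eq i₀ x hxdet, ← smul_smul]
    congr 1
    rw [← Matrix.fromBlocks_toBlocks Z.1, ← hB, hxA, hxS, hxμ, hinv, Matrix.fromBlocks_smul,
      smul_smul, mul_assoc a⁻¹, inv_mul_cancel₀ ha, mul_one, Matrix.smul_mul, Matrix.mul_smul,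
      Matrix.smul_mul, hAS, hSA, ← smul_add, ← hSA, ← hC]

/-- The closure of the orbit of the identity is irreducible of dimension `r (r + 1)`. -/
theorem dim_closure_orbit_idMat [IsAlgClosed K] [CharZero K] (i₀ : Fin r) (h₀ : idMat K r ≠ 0) :
    IsIrreducible (closure (MulAction.orbit (Matrix.symplecticGroup (Fin r) K)
      (Projectivization.mk K (idMat K r) h₀))) ∧
    topologicalKrullDim (closure (MulAction.orbit (Matrix.symplecticGroup (Fin r) K)
      (Projectivization.mk K (idMat K r) h₀))) = ((r * (r + 1) : ℕ) : WithBot ℕ∞) := by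
  have heq : closure (MulAction.orbit (Matrix.symplecticGroup (Fin r) K)
      (Projectivization.mk K (idMat K r) h₀)) =
      closure (projImage (idParam i₀) {x | (idA i₀ x).det * idMu i₀ x ≠ 0}) :=
    (closure_minimal (orbit_subset_closure_projImage_idParam i₀ h₀) isClosed_closure).antisymm
      (closure_mono (projImage_idParam_subset i₀ h₀))
  rw [heq, ← card_idIndex i₀]
  refine dim_closure_projImage (matMem_idParam i₀) (idDenom_mem i₀)
    (x₀ := Sum.elim (fun e => symCoords (Matrix.isSymm_one (α := K)) e.1) fun _ => 1) ?_
    (idParam_ne_zero i₀) (idCoord_mem_regFun i₀)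
  have h1 : ∀ f, idA i₀ (Sum.elim (fun e => symCoords (Matrix.isSymm_one (α := K)) e.1) f) = 1 :=
    fun f => symOf_extendOne_one i₀
  rw [h1]
  simp [idMu]

end IdentityOrbit

/-! ### The open cell of the orbit of `I_k` -/

section PartialOrbit

variable {K : Type*} {k n : ℕ}

/-- A block matrix with blocks of sizes `k` and `n`, as a matrix of size `k + n`. -/
def ofBlocks (A : Matrix (Fin k) (Fin k) K) (B : Matrix (Fin k) (Fin n) K)
    (C : Matrix (Fin n) (Fin k) K) (D : Matrix (Fin n) (Fin n) K) :
    Matrix (Fin (k + n)) (Fin (k + n)) K :=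
  (Matrix.fromBlocks A B C D).submatrix finSumFinEquiv.symm finSumFinEquiv.symm

theorem ofBlocks_transpose (A : Matrix (Fin k) (Fin k) K) (B : Matrix (Fin k) (Fin n) K)
    (C : Matrix (Fin n) (Fin k) K) (D : Matrix (Fin n) (Fin n) K) :
    (ofBlocks A B C D)ᵀ = ofBlocks Aᵀ Cᵀ Bᵀ Dᵀ := by
  rw [ofBlocks, Matrix.transpose_submatrix, Matrix.fromBlocks_transpose, ofBlocks]

theorem exists_eq_ofBlocks (M : Matrix (Fin (k + n)) (Fin (k + n)) K) :
    ∃ A B C D, M = ofBlocks A B C D := by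
  let N := M.submatrix finSumFinEquiv finSumFinEquiv
  refine ⟨N.toBlocks₁₁, N.toBlocks₁₂, N.toBlocks₂₁, N.toBlocks₂₂, ?_⟩
  rw [ofBlocks, Matrix.fromBlocks_toBlocks]
  simp [N]

theorem ofBlocks_inj {A A' : Matrix (Fin k) (Fin k) K} {B B' : Matrix (Fin k) (Fin n) K}
    {C C' : Matrix (Fin n) (Fin k) K} {D D' : Matrix (Fin n) (Fin n) K} :
    ofBlocks A B C D = ofBlocks A' B' C' D' ↔ A = A' ∧ B = B' ∧ C = C' ∧ D = D' := by
  rw [← Matrix.fromBlocks_inj]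
  refine ⟨fun h => ?_, fun h => by rw [ofBlocks, h, ofBlocks]⟩
  have := congrArg (fun M => M.submatrix finSumFinEquiv finSumFinEquiv) h
  simpa [ofBlocks] using this

theorem ofBlocks_submatrix_castAdd (A : Matrix (Fin k) (Fin k) K) (B : Matrix (Fin k) (Fin n) K)
    (C : Matrix (Fin n) (Fin k) K) (D : Matrix (Fin n) (Fin n) K) :
    (ofBlocks A B C D).submatrix (Fin.castAdd n) (Fin.castAdd n) = A := by
  ext i j
  simp [ofBlocks]

theorem ofBlocks_submatrix_natAdd_castAdd (A : Matrix (Fin k) (Fin k) K)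
    (B : Matrix (Fin k) (Fin n) K) (C : Matrix (Fin n) (Fin k) K) (D : Matrix (Fin n) (Fin n) K) :
    (ofBlocks A B C D).submatrix (Fin.natAdd k) (Fin.castAdd n) = C := by
  ext i j
  simp [ofBlocks]

variable [Field K]

theorem ofBlocks_mul (A A' : Matrix (Fin k) (Fin k) K) (B B' : Matrix (Fin k) (Fin n) K)
    (C C' : Matrix (Fin n) (Fin k) K) (D D' : Matrix (Fin n) (Fin n) K) :
    ofBlocks A B C D * ofBlocks A' B' C' D' =
      ofBlocks (A * A' + B * C') (A * B' + B * D') (C * A' + D * C') (C * B' + D * D') := by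
  rw [ofBlocks, ofBlocks, Matrix.submatrix_mul_equiv, Matrix.fromBlocks_multiply, ofBlocks]

theorem ofBlocks_smul (c : K) (A : Matrix (Fin k) (Fin k) K) (B : Matrix (Fin k) (Fin n) K)
    (C : Matrix (Fin n) (Fin k) K) (D : Matrix (Fin n) (Fin n) K) :
    ofBlocks (c • A) (c • B) (c • C) (c • D) = c • ofBlocks A B C D := by
  rw [ofBlocks, ← Matrix.fromBlocks_smul, ofBlocks]
  rfl

theorem det_ofBlocks_lower (g : Matrix (Fin k) (Fin k) K) (C : Matrix (Fin n) (Fin k) K) :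
    (ofBlocks g 0 C 1).det = g.det := by
  rw [ofBlocks, Matrix.det_submatrix_equiv_self, Matrix.det_fromBlocks_zero₁₂]
  simp

theorem MatMem.ofBlocks {X : Type*} {R : Subalgebra K (X → K)} {A : X → Matrix (Fin k) (Fin k) K}
    {B : X → Matrix (Fin k) (Fin n) K} {C : X → Matrix (Fin n) (Fin k) K}
    {D : X → Matrix (Fin n) (Fin n) K} (hA : MatMem R A) (hB : MatMem R B) (hC : MatMem R C)
    (hD : MatMem R D) : MatMem R fun x => ofBlocks (A x) (B x) (C x) (D x) :=
  (hA.fromBlocks hB hC hD).submatrix _ _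

theorem partialId_eq : (partialId K (k + n) k).1 =
    Matrix.fromBlocks (ofBlocks 1 0 0 0) 0 0 0 := by
  have h : ∀ i j : Fin (k + n), ofBlocks (1 : Matrix (Fin k) (Fin k) K) 0 0
      (0 : Matrix (Fin n) (Fin n) K) i j =
      Matrix.diagonal (fun i : Fin (k + n) => if (i : ℕ) < k then (1 : K) else 0) i j := by
    intro i j
    refine Fin.addCases (fun i => ?_) (fun i => ?_) i <;>
    refine Fin.addCases (fun j => ?_) (fun j => ?_) j
    · simp [ofBlocks, Matrix.one_apply, Matrix.diagonal_apply, Fin.ext_iff]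
    · have : (i : ℕ) ≠ k + j := by omega
      simp [ofBlocks, Fin.ext_iff, this]
    · simp [ofBlocks, Matrix.diagonal_apply]
    · simp [ofBlocks, Matrix.diagonal_apply]
  ext (i | i) (j | j)
  · rw [Matrix.fromBlocks_apply₁₁, h]
    by_cases hij : i = j
    · subst hij
      simp only [partialId, Matrix.diagonal_apply_eq, finSumFinEquiv_apply_left, Fin.val_castAdd]
      exact if_congr Iff.rfl rfl rfl
    · simp [partialId, hij]
  · simp [partialId]
  · simp [partialId]
  · simp [partialId, Matrix.diagonal_apply]
    omega

variable (i₀ : Fin k) (n)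

/-- The index set of the coordinates `(D, s, b, d)` on the open cell of the orbit of `I_k`: the
`k × k` matrices `D` and `s` are symmetric, with `D i₀ i₀ = 1`, and `b` and `d` are `n × k`. -/
abbrev PartialIndex : Type := OffPair i₀ ⊕ Sym2 (Fin k) ⊕ (Fin n × Fin k) ⊕ (Fin n × Fin k)

/-- The symmetric matrix `D` of the coordinates `(D, s, b, d)`. -/
def partD (x : PartialIndex n i₀ → K) : Matrix (Fin k) (Fin k) K :=
  symOf (extendOne i₀ fun e => x (.inl e))

/-- The symmetric matrix `s` of the coordinates `(D, s, b, d)`. -/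
def partS {K : Type*} (x : PartialIndex n i₀ → K) : Matrix (Fin k) (Fin k) K :=
  symOf fun e => x (.inr (.inl e))

/-- The matrix `b` of the coordinates `(D, s, b, d)`. -/
def partB {K : Type*} (x : PartialIndex n i₀ → K) : Matrix (Fin n) (Fin k) K :=
  Matrix.of fun i j => x (.inr (.inr (.inl (i, j))))

/-- The matrix `d` of the coordinates `(D, s, b, d)`. -/
def partE {K : Type*} (x : PartialIndex n i₀ → K) : Matrix (Fin n) (Fin k) K :=
  Matrix.of fun i j => x (.inr (.inr (.inr (i, j))))

theorem partD_isSymm (x : PartialIndex n i₀ → K) : (partD n i₀ x).IsSymm := symOf_isSymm _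

theorem partS_isSymm {K : Type*} (x : PartialIndex n i₀ → K) : (partS n i₀ x).IsSymm :=
  symOf_isSymm _

variable {n}

/-- The symmetric matrix `(1; b) D (1; b)ᵗ` of size `k + n`. -/
def graphMat (D : Matrix (Fin k) (Fin k) K) (b : Matrix (Fin n) (Fin k) K) :
    Matrix (Fin (k + n)) (Fin (k + n)) K :=
  ofBlocks D (D * bᵀ) (b * D) (b * D * bᵀ)

/-- The symmetric matrix `((s, dᵗ), (d, 0))` of size `k + n`. -/
def shearMat (s : Matrix (Fin k) (Fin k) K) (d : Matrix (Fin n) (Fin k) K) :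
    Matrix (Fin (k + n)) (Fin (k + n)) K :=
  ofBlocks s dᵀ d 0

theorem graphMat_isSymm {D : Matrix (Fin k) (Fin k) K} (hD : D.IsSymm)
    (b : Matrix (Fin n) (Fin k) K) : (graphMat D b).IsSymm := by
  rw [Matrix.IsSymm, graphMat, ofBlocks_transpose]
  simp only [Matrix.transpose_mul, Matrix.transpose_transpose, hD.eq, Matrix.mul_assoc]

theorem shearMat_isSymm {s : Matrix (Fin k) (Fin k) K} (hs : s.IsSymm)
    (d : Matrix (Fin n) (Fin k) K) : (shearMat s d).IsSymm := by
  rw [Matrix.IsSymm, shearMat, ofBlocks_transpose]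
  simp [hs.eq]

variable (n)

/-- The parametrization `((W, WT), (TW, TWT))` of the open cell of the orbit of `I_k`, where
`W = (1; b) D (1; b)ᵗ` and `T = ((s, dᵗ), (d, 0))`. -/
def partialParam (x : PartialIndex n i₀ → K) : SymMat K (k + n) :=
  ⟨Matrix.fromBlocks 1 0 (shearMat (partS n i₀ x) (partE n i₀ x)) 1 *
    Matrix.fromBlocks (graphMat (partD n i₀ x) (partB n i₀ x)) 0 0 0 *
    (Matrix.fromBlocks 1 0 (shearMat (partS n i₀ x) (partE n i₀ x)) 1)ᵀ,
    mul_mul_transpose_isSymm _ (by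
      rw [Matrix.isSymm_fromBlocks_iff]
      exact ⟨graphMat_isSymm (partD_isSymm n i₀ x) _, by simp, by simp, by simp⟩)⟩

theorem partialParam_eq (x : PartialIndex n i₀ → K) :
    (partialParam n i₀ x).1 =
      Matrix.fromBlocks (graphMat (partD n i₀ x) (partB n i₀ x))
        (graphMat (partD n i₀ x) (partB n i₀ x) * shearMat (partS n i₀ x) (partE n i₀ x))
        (shearMat (partS n i₀ x) (partE n i₀ x) * graphMat (partD n i₀ x) (partB n i₀ x))
        (shearMat (partS n i₀ x) (partE n i₀ x) * graphMat (partD n i₀ x) (partB n i₀ x) *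
          shearMat (partS n i₀ x) (partE n i₀ x)) :=
  (lower_mul_fromBlocks_mul _ _ (shearMat_isSymm (partS_isSymm n i₀ x) _)).trans (by
    rw [add_zero])

theorem matMem_partialParam :
    MatMem (polyFun K (PartialIndex n i₀)) fun x => (partialParam n i₀ x).1 := by
  have hD : MatMem (polyFun K (PartialIndex n i₀)) (partD n i₀) :=
    MatMem.symOf (extendOne_mem fun _ => coord_mem_polyFun _)
  have hS : MatMem (polyFun K (PartialIndex n i₀)) (partS n i₀) :=
    MatMem.symOf fun _ => coord_mem_polyFun _
  have hB : MatMem (polyFun K (PartialIndex n i₀)) (partB n i₀) := fun _ _ => coord_mem_polyFun _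
  have hE : MatMem (polyFun K (PartialIndex n i₀)) (partE n i₀) := fun _ _ => coord_mem_polyFun _
  have hW : MatMem (polyFun K (PartialIndex n i₀)) fun x =>
      graphMat (partD n i₀ x) (partB n i₀ x) :=
    hD.ofBlocks (hD.mul hB.transpose) (hB.mul hD) ((hB.mul hD).mul hB.transpose)
  have hT : MatMem (polyFun K (PartialIndex n i₀)) fun x =>
      shearMat (partS n i₀ x) (partE n i₀ x) :=
    hS.ofBlocks hE.transpose hE (MatMem.const 0)
  simp only [partialParam_eq]
  exact hW.fromBlocks (hW.mul hT) (hT.mul hW) ((hT.mul hW).mul hT)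

theorem partDenom_mem : (fun x => (partD n i₀ x).det) ∈ polyFun K (PartialIndex n i₀) :=
  MatMem.det (MatMem.symOf (extendOne_mem fun _ => coord_mem_polyFun _))

theorem partialParam_apply (x : PartialIndex n i₀ → K) :
    (partialParam n i₀ x).1 (.inl (Fin.castAdd n i₀)) (.inl (Fin.castAdd n i₀)) = 1 := by
  rw [partialParam_eq]
  simp [graphMat, ofBlocks, partD, symOf_extendOne_self]

theorem partialParam_ne_zero (x : PartialIndex n i₀ → K) : partialParam n i₀ x ≠ 0 := by
  intro h0
  have := partialParam_apply n i₀ x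
  rw [h0] at this
  exact zero_ne_one this

theorem shearMat_mul_graphMat (D s : Matrix (Fin k) (Fin k) K) (b d : Matrix (Fin n) (Fin k) K) :
    shearMat s d * graphMat D b = ofBlocks (s * D + dᵀ * (b * D)) (s * (D * bᵀ) + dᵀ * (b * D * bᵀ))
      (d * D) (d * (D * bᵀ)) := by
  rw [shearMat, graphMat, ofBlocks_mul]
  simp

/-- The coordinates `(D, s, b, d)` are regular on the cell: the first `k` columns of `W` and of `TW`
are `(D; bD)` and `(sD + dᵗbD; dD)`. -/
theorem partCoord_mem_regFun (i : PartialIndex n i₀) :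
    (fun x : {x : PartialIndex n i₀ → K | (partD n i₀ x).det ≠ 0} => x.1 i) ∈
      regFun (partialParam n i₀) {x | (partD n i₀ x).det ≠ 0} := by
  set U := {x : PartialIndex n i₀ → K | (partD n i₀ x).det ≠ 0}
  have hZ : MatMem (regFun (partialParam n i₀) U) fun x : U => (partialParam n i₀ x.1).1 := by
    have := matMem_regFun_smul (φ := partialParam n i₀) (U := U) (.inl (Fin.castAdd n i₀))
      (.inl (Fin.castAdd n i₀)) fun x _ => by
        rw [partialParam_apply]
        exact one_ne_zero
    simpa only [partialParam_apply, inv_one, one_smul] using this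
  simp only [partialParam_eq] at hZ
  have hW : MatMem (regFun (partialParam n i₀) U) fun x : U =>
      graphMat (partD n i₀ x.1) (partB n i₀ x.1) := hZ.submatrix .inl .inl
  have hTW : MatMem (regFun (partialParam n i₀) U) fun x : U =>
      shearMat (partS n i₀ x.1) (partE n i₀ x.1) * graphMat (partD n i₀ x.1) (partB n i₀ x.1) :=
    hZ.submatrix .inr .inl
  have hD : MatMem (regFun (partialParam n i₀) U) fun x : U => partD n i₀ x.1 := by
    have := hW.submatrix (Fin.castAdd n) (Fin.castAdd n)
    simpa only [graphMat, ofBlocks_submatrix_castAdd] using this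
  have hinv : MatMem (regFun (partialParam n i₀) U) fun x : U => (partD n i₀ x.1)⁻¹ :=
    hD.inv_regFun fun x => x.2
  have hi : ∀ x : U, partD n i₀ x.1 * (partD n i₀ x.1)⁻¹ = 1 := fun x =>
    Matrix.mul_nonsing_inv _ (isUnit_iff_ne_zero.2 x.2)
  have hB : MatMem (regFun (partialParam n i₀) U) fun x : U => partB n i₀ x.1 := by
    have := (hW.submatrix (Fin.natAdd k) (Fin.castAdd n)).mul hinv
    simpa only [graphMat, ofBlocks_submatrix_natAdd_castAdd, Matrix.mul_assoc, hi,
      Matrix.mul_one] using this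
  have hE : MatMem (regFun (partialParam n i₀) U) fun x : U => partE n i₀ x.1 := by
    have := (hTW.submatrix (Fin.natAdd k) (Fin.castAdd n)).mul hinv
    simpa only [shearMat_mul_graphMat, ofBlocks_submatrix_natAdd_castAdd, Matrix.mul_assoc, hi,
      Matrix.mul_one] using this
  have hS : MatMem (regFun (partialParam n i₀) U) fun x : U => partS n i₀ x.1 := by
    have := ((hTW.submatrix (Fin.castAdd n) (Fin.castAdd n)).mul hinv).sub (hE.transpose.mul hB)
    simpa only [shearMat_mul_graphMat, ofBlocks_submatrix_castAdd, Matrix.add_mul,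
      Matrix.mul_assoc, hi, Matrix.mul_one, add_sub_cancel_right] using this
  rcases i with e | e | e | e
  · exact coord_mem_of_matMem_extendOne (f := fun (x : U) e => x.1 (.inl e)) hD e
  · exact coord_mem_of_matMem_symOf (f := fun (x : U) e => x.1 (.inr (.inl e))) hS e
  · exact hB e.1 e.2
  · exact hE e.1 e.2

theorem card_partialIndex :
    Fintype.card (PartialIndex n i₀) + 1 = k * (k + 1) + 2 * n * k := by
  rw [Fintype.card_sum, Fintype.card_sum, Fintype.card_sum, card_offPair, card_sym2_fin,
    Fintype.card_prod, Fintype.card_fin, Fintype.card_fin]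
  have h := Nat.div_mul_cancel (Nat.even_mul_succ_self k).two_dvd
  have hk : 0 < k := i₀.pos
  have : 0 < k * (k + 1) := by positivity
  have e : 2 * n * k = n * k + n * k := by ring
  omega

/-- If `D = g gᵗ` and `G = ((g, 0), (bg, 1))`, then `u₋(T) diag(G, G⁻ᵗ)` moves `I_k` to the point
with coordinates `(D, s, b, d)`. -/
theorem projImage_partialParam_subset [IsAlgClosed K] [CharZero K]
    (h₀ : partialId K (k + n) k ≠ 0) :
    projImage (partialParam n i₀) {x | (partD n i₀ x).det ≠ 0} ⊆
      MulAction.orbit (Matrix.symplecticGroup (Fin (k + n)) K)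
        (Projectivization.mk K (partialId K (k + n) k) h₀) := by
  rintro _ ⟨x, hx, hne, rfl⟩
  obtain ⟨g, hg, hD⟩ := exists_eq_mul_transpose (partD_isSymm n i₀ x) hx
  set G : Matrix (Fin (k + n)) (Fin (k + n)) K := ofBlocks g 0 (partB n i₀ x * g) 1
  have hG : G.det ≠ 0 := by rwa [det_ofBlocks_lower]
  have hW : G * ofBlocks 1 0 0 0 * Gᵀ = graphMat (partD n i₀ x) (partB n i₀ x) := by
    rw [ofBlocks_transpose, ofBlocks_mul, ofBlocks_mul, graphMat, hD]
    simp [Matrix.mul_assoc]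
  let M : Matrix.symplecticGroup (Fin (k + n)) K :=
    ⟨_, mul_mem (fromBlocks_lower_mem (shearMat_isSymm (partS_isSymm n i₀ x) (partE n i₀ x)))
      (fromBlocks_levi_mem hG)⟩
  refine ⟨M, ?_⟩
  change M • Projectivization.mk K (partialId K (k + n) k) h₀ = _
  rw [Projectivization.smul_mk]
  refine (mk_eq_mk_of_coe_eq_smul _ _ 1 ?_).symm
  have h2 : Matrix.fromBlocks (graphMat (partD n i₀ x) (partB n i₀ x)) 0 0 0 =
      Matrix.fromBlocks G 0 0 G⁻¹ᵀ * (partialId K (k + n) k).1 *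
        (Matrix.fromBlocks G 0 0 G⁻¹ᵀ)ᵀ := by
    rw [partialId_eq, Matrix.fromBlocks_transpose, Matrix.fromBlocks_multiply,
      Matrix.fromBlocks_multiply, ← hW]
    simp
  have hval : (partialParam n i₀ x).1 =
    Matrix.fromBlocks 1 0 (shearMat (partS n i₀ x) (partE n i₀ x)) 1 *
    Matrix.fromBlocks (graphMat (partD n i₀ x) (partB n i₀ x)) 0 0 0 *
    (Matrix.fromBlocks 1 0 (shearMat (partS n i₀ x) (partE n i₀ x)) 1)ᵀ := rfl
  rw [coe_symplectic_smul, one_smul, hval, h2]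
  simp only [M, Matrix.transpose_mul, Matrix.mul_assoc]

/-- A symplectic matrix, whose upper left `k × k` block is invertible, moves `I_k` into the cell
parametrized by `partialParam`, up to the normalization of `D`. -/
theorem exists_eq_fromBlocks_of_symplectic (M : Matrix.symplecticGroup (Fin (k + n)) K)
    (hdet : ((M • partialId K (k + n) k).1.submatrix (fun i : Fin k => Sum.inl (Fin.castAdd n i))
      (fun i : Fin k => Sum.inl (Fin.castAdd n i))).det ≠ 0) :
    ∃ (D s : Matrix (Fin k) (Fin k) K) (b d : Matrix (Fin n) (Fin k) K), D.IsSymm ∧ s.IsSymm ∧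
      (M • partialId K (k + n) k).1 = Matrix.fromBlocks (graphMat D b)
        (graphMat D b * shearMat s d) (shearMat s d * graphMat D b)
        (shearMat s d * graphMat D b * shearMat s d) := by
  have hM := M.2
  have hval := coe_symplectic_smul M (partialId K (k + n) k)
  rw [← Matrix.fromBlocks_toBlocks M.1] at hM hval
  obtain ⟨hac, -, -⟩ := SymplecticGroup.fromBlocks_mem_iff.1 hM
  obtain ⟨a₁, a₂, b, a₄, ha⟩ := exists_eq_ofBlocks M.1.toBlocks₁₁
  obtain ⟨c₁, c₂, d, c₄, hc⟩ := exists_eq_ofBlocks M.1.toBlocks₂₁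
  rw [partialId_eq, Matrix.fromBlocks_transpose, Matrix.fromBlocks_multiply,
    Matrix.fromBlocks_multiply, ha, hc] at hval
  simp only [Matrix.mul_zero, add_zero, Matrix.zero_mul] at hval
  rw [ha, hc, ofBlocks_transpose, ofBlocks_transpose, ofBlocks_mul, ofBlocks_mul,
    ofBlocks_inj] at hac
  have hsym : a₁ᵀ * c₁ + bᵀ * d = c₁ᵀ * a₁ + dᵀ * b := hac.1
  have hE : ∀ (a₁ : Matrix (Fin k) (Fin k) K) (a₂ : Matrix (Fin k) (Fin n) K)
      (b : Matrix (Fin n) (Fin k) K) (a₄ : Matrix (Fin n) (Fin n) K),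
      ofBlocks a₁ a₂ b a₄ * ofBlocks 1 0 0 0 = ofBlocks a₁ 0 b 0 := by
    intro a₁ a₂ b a₄
    rw [ofBlocks_mul]
    simp
  rw [hE, hE] at hval
  have hW : ofBlocks a₁ 0 b (0 : Matrix (Fin n) (Fin n) K) * (ofBlocks a₁ a₂ b a₄)ᵀ =
      ofBlocks (a₁ * a₁ᵀ) (a₁ * bᵀ) (b * a₁ᵀ) (b * bᵀ) := by
    rw [ofBlocks_transpose, ofBlocks_mul]
    simp
  have ha₁ : a₁.det ≠ 0 := by
    intro h
    apply hdet
    have : (M • partialId K (k + n) k).1.submatrix (fun i : Fin k => Sum.inl (Fin.castAdd n i))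
        (fun i : Fin k => Sum.inl (Fin.castAdd n i)) = a₁ * a₁ᵀ := by
      rw [hval, hW]
      ext i j
      simp [ofBlocks]
    rw [this, Matrix.det_mul, h, zero_mul]
  have hu := isUnit_iff_ne_zero.2 ha₁
  have hi : a₁⁻¹ * a₁ = 1 := Matrix.nonsing_inv_mul _ hu
  have hi' : a₁ * a₁⁻¹ = 1 := Matrix.mul_nonsing_inv _ hu
  have hit : a₁⁻¹ᵀ * a₁ᵀ = 1 := by rw [← Matrix.transpose_mul, hi', Matrix.transpose_one]
  set β := b * a₁⁻¹ with hβ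
  set δ := d * a₁⁻¹ with hδ
  set s := c₁ * a₁⁻¹ - δᵀ * β with hs
  have hβa : β * a₁ = b := by rw [hβ, Matrix.mul_assoc, hi, Matrix.mul_one]
  have hδa : δ * a₁ = d := by rw [hδ, Matrix.mul_assoc, hi, Matrix.mul_one]
  have hs_eq : s = a₁⁻¹ᵀ * (a₁ᵀ * c₁ - dᵀ * b) * a₁⁻¹ᵀᵀ := by
    rw [hs, hδ, hβ, Matrix.transpose_transpose, Matrix.mul_sub, Matrix.sub_mul,
      ← Matrix.mul_assoc a₁⁻¹ᵀ a₁ᵀ, hit, Matrix.one_mul, Matrix.transpose_mul]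
    simp only [Matrix.mul_assoc]
  have hs_symm : s.IsSymm := by
    rw [hs_eq]
    refine mul_mul_transpose_isSymm _ ?_
    rw [Matrix.IsSymm]
    simp only [Matrix.transpose_sub, Matrix.transpose_mul, Matrix.transpose_transpose]
    rw [sub_eq_sub_iff_add_eq_add, hsym, add_comm]
  have hc₁ : s * a₁ + δᵀ * b = c₁ := by
    rw [hs, Matrix.sub_mul, Matrix.mul_assoc, hi, Matrix.mul_one, Matrix.mul_assoc, hβa,
      sub_add_cancel]
  -- the shear `T` carries the first `k` columns of the upper half to those of the lower half
  have hT : ofBlocks c₁ 0 d (0 : Matrix (Fin n) (Fin n) K) =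
      shearMat s δ * ofBlocks a₁ 0 b (0 : Matrix (Fin n) (Fin n) K) := by
    rw [shearMat, ofBlocks_mul]
    simp [hc₁, hδa]
  have hgraph : ofBlocks a₁ 0 b (0 : Matrix (Fin n) (Fin n) K) * (ofBlocks a₁ a₂ b a₄)ᵀ =
      graphMat (a₁ * a₁ᵀ) β := by
    have h1 : b * a₁ᵀ = β * (a₁ * a₁ᵀ) := by rw [← Matrix.mul_assoc, hβa]
    have h2 : a₁ * bᵀ = a₁ * a₁ᵀ * βᵀ := by
      rw [Matrix.mul_assoc, ← Matrix.transpose_mul, hβa]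
    have h3 : b * bᵀ = β * (a₁ * a₁ᵀ) * βᵀ := by
      rw [← h1, Matrix.mul_assoc, ← Matrix.transpose_mul, hβa]
    rw [hW, graphMat, h1, h2, h3]
  have hright : ∀ L : Matrix (Fin (k + n)) (Fin (k + n)) K,
      L * ofBlocks 1 0 0 0 * (ofBlocks c₁ c₂ d c₄)ᵀ =
        L * ofBlocks 1 0 0 0 * (ofBlocks a₁ a₂ b a₄)ᵀ * shearMat s δ := by
    intro L
    have e : ∀ X : Matrix (Fin (k + n)) (Fin (k + n)) K,
        L * ofBlocks 1 0 0 (0 : Matrix (Fin n) (Fin n) K) * Xᵀ =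
        L * (X * ofBlocks 1 0 0 (0 : Matrix (Fin n) (Fin n) K))ᵀ := by
      intro X
      rw [Matrix.transpose_mul, ofBlocks_transpose, Matrix.mul_assoc]
      simp
    rw [e, e, hE, hE, hT, Matrix.transpose_mul, (shearMat_isSymm hs_symm δ).eq, Matrix.mul_assoc]
  have hEE : ∀ (a₁ : Matrix (Fin k) (Fin k) K) (b : Matrix (Fin n) (Fin k) K),
      ofBlocks a₁ 0 b (0 : Matrix (Fin n) (Fin n) K) =
      ofBlocks a₁ 0 b (0 : Matrix (Fin n) (Fin n) K) * ofBlocks 1 0 0 0 :=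
    fun a₁ b => (hE _ _ _ _).symm
  refine ⟨a₁ * a₁ᵀ, s, β, δ, ?_, hs_symm, ?_⟩
  · rw [Matrix.IsSymm, Matrix.transpose_mul, Matrix.transpose_transpose]
  · rw [hval, Matrix.fromBlocks_inj]
    refine ⟨hgraph, ?_, ?_, ?_⟩
    · rw [hEE a₁ b, hright, ← hEE, hgraph]
    · rw [hT, Matrix.mul_assoc, hgraph]
    · rw [hEE c₁ d, hright, ← hEE, hT, Matrix.mul_assoc (shearMat s δ), hgraph]

/-- The cell is dense in the orbit of `I_k`: it contains all points at which neither the diagonal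
entry at `i₀` nor the determinant of the upper left `k × k` block vanishes. -/
theorem orbit_subset_closure_projImage_partialParam [Infinite K]
    (h₀ : partialId K (k + n) k ≠ 0) :
    MulAction.orbit (Matrix.symplecticGroup (Fin (k + n)) K)
        (Projectivization.mk K (partialId K (k + n) k) h₀) ⊆
      closure (projImage (partialParam n i₀) {x | (partD n i₀ x).det ≠ 0}) := by
  let ι : Fin k → Fin (k + n) ⊕ Fin (k + n) := fun i => Sum.inl (Fin.castAdd n i)
  have hev : ∀ Z : SymMat K (k + n), evalAt Z (MvPolynomial.X (ι i₀, ι i₀) *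
      (Matrix.of fun i j => (MvPolynomial.X (ι i, ι j) : EntryPoly K (k + n))).det) =
      Z.1 (ι i₀) (ι i₀) * (Z.1.submatrix ι ι).det := fun Z => by
    rw [← evalAt_det_X]
    simp only [evalAt, map_mul, MvPolynomial.eval_X]
  refine orbit_subset_closure h₀ ((MvPolynomial.isHomogeneous_X K (ι i₀, ι i₀)).mul
    (isHomogeneous_det_X ι)) ?_ ?_
  · rw [hev, partialId_eq]
    have h1 : (Matrix.fromBlocks (ofBlocks 1 0 0 0) 0 0 0 :
        Matrix (Fin (k + n) ⊕ Fin (k + n)) (Fin (k + n) ⊕ Fin (k + n)) K).submatrix ι ι = 1 := by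
      ext i j
      simp [ofBlocks, ι]
    rw [h1]
    simp [ofBlocks, ι]
  · intro M hne hM
    rw [hev] at hM
    have ha := left_ne_zero_of_mul hM
    have hdet := right_ne_zero_of_mul hM
    obtain ⟨D, s, b, d, hD, hs, hZ⟩ := exists_eq_fromBlocks_of_symplectic n M hdet
    have hDi : (M • partialId K (k + n) k).1 (ι i₀) (ι i₀) = D i₀ i₀ := by
      rw [hZ]
      simp [graphMat, ofBlocks, ι]
    have hDd : ((M • partialId K (k + n) k).1.submatrix ι ι) = D := by
      rw [hZ]
      ext i j
      simp [graphMat, ofBlocks, ι]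
    rw [hDi] at ha
    rw [hDd] at hdet
    set a := D i₀ i₀
    have hDs : (a⁻¹ • D).IsSymm := hD.smul _
    -- the coordinates of the point
    let x : PartialIndex n i₀ → K := Sum.elim (fun e => symCoords hDs e.1)
      (Sum.elim (symCoords hs) (Sum.elim (fun e => b e.1 e.2) fun e => d e.1 e.2))
    have hxD : partD n i₀ x = a⁻¹ • D := symOf_extendOne_symCoords hDs (inv_mul_cancel₀ ha)
    have hxS : partS n i₀ x = s := symOf_symCoords hs
    have hxB : partB n i₀ x = b := rfl
    have hxE : partE n i₀ x = d := rfl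
    have hxdet : (partD n i₀ x).det ≠ 0 := by
      rw [hxD, Matrix.det_smul]
      exact mul_ne_zero (pow_ne_zero _ (inv_ne_zero ha)) hdet
    refine ⟨x, hxdet, partialParam_ne_zero n i₀ x, ?_⟩
    refine (mk_eq_mk_of_coe_eq_smul _ _ a⁻¹ ?_).symm
    have hgr : graphMat (a⁻¹ • D) b = a⁻¹ • graphMat D b := by
      rw [graphMat, graphMat, ← ofBlocks_smul]
      simp only [Matrix.smul_mul, Matrix.mul_smul]
    rw [partialParam_eq, hZ, hxD, hxS, hxB, hxE, hgr, Matrix.fromBlocks_smul]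
    simp only [Matrix.smul_mul, Matrix.mul_smul]

/-- The dimension of the closure of the orbit of `I_k`, in size `2 (k + n)`; see `card_partialIndex`
for its value `k (k + 1) + 2nk - 1`. -/
theorem dim_closure_orbit_partialId [IsAlgClosed K] [CharZero K] (h₀ : partialId K (k + n) k ≠ 0) :
    topologicalKrullDim (closure (MulAction.orbit (Matrix.symplecticGroup (Fin (k + n)) K)
      (Projectivization.mk K (partialId K (k + n) k) h₀))) =
      (Fintype.card (PartialIndex n i₀) : WithBot ℕ∞) := by
  have heq : closure (MulAction.orbit (Matrix.symplecticGroup (Fin (k + n)) K)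
      (Projectivization.mk K (partialId K (k + n) k) h₀)) =
      closure (projImage (partialParam n i₀) {x | (partD n i₀ x).det ≠ 0}) :=
    (closure_minimal (orbit_subset_closure_projImage_partialParam n i₀ h₀)
      isClosed_closure).antisymm (closure_mono (projImage_partialParam_subset n i₀ h₀))
  rw [heq]
  refine (dim_closure_projImage (matMem_partialParam n i₀) (partDenom_mem n i₀)
    (x₀ := Sum.elim (fun e => symCoords (Matrix.isSymm_one (α := K)) e.1) fun _ => 0) ?_
    (fun x _ => partialParam_ne_zero n i₀ x) (partCoord_mem_regFun n i₀)).2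
  have h1 : ∀ f, partD n i₀
      (Sum.elim (fun e => symCoords (Matrix.isSymm_one (α := K)) e.1) f) = 1 :=
    fun f => symOf_extendOne_one i₀
  rw [h1]
  simp

end PartialOrbit

theorem partialId_two_mul (K : Type*) [Field K] (r : ℕ) : partialId K r (2 * r) = idMat K r := by
  refine Subtype.ext ?_
  have h : ∀ i : Fin r ⊕ Fin r, (finSumFinEquiv i : ℕ) < 2 * r := fun i => by
    have := (finSumFinEquiv i).isLt
    omega
  simp only [partialId, idMat, h, if_true]
  exact Matrix.diagonal_one

end SymplecticQuadrics

theorem proposition3p3 (K : Type*) [Field K] [IsAlgClosed K] [CharZero K] (r : ℕ) (hr : 1 ≤ r) :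
    (∀ (k : ℕ) (hk : 1 ≤ k), k ≤ r →
      ∃ d : ℕ, topologicalKrullDim (SymplecticQuadrics.Y K r k hr hk) = (d : WithBot ℕ∞) ∧
        (d : ℚ) = r * (2 * r + 1) - k * (k - 1) / 2 - r * (r - k) - r * (r + 1) / 2
          - (r - k) * (r - k + 1) / 2 - 1 ∧
        (d : ℚ) = 2 * r * k + k - k ^ 2 - 1) ∧
    topologicalKrullDim (SymplecticQuadrics.Y K r (2 * r) hr (by omega))
      = ((r * (r + 1) : ℕ) : WithBot ℕ∞) ∧
    IsIrreducible (SymplecticQuadrics.X K r hr) ∧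
    topologicalKrullDim (SymplecticQuadrics.X K r hr) = ((r * (r + 1) : ℕ) : WithBot ℕ∞) := by
  have hX := SymplecticQuadrics.dim_closure_orbit_idMat (K := K) ⟨0, hr⟩
    (SymplecticQuadrics.idMat_ne_zero K hr)
  refine ⟨fun k hk hkr => ?_, ?_, hX.1, hX.2⟩
  · obtain ⟨n, rfl⟩ := Nat.exists_eq_add_of_le hkr
    refine ⟨_, SymplecticQuadrics.dim_closure_orbit_partialId n ⟨0, hk⟩ _, ?_⟩
    have h := congrArg (Nat.cast (R := ℚ))
      (SymplecticQuadrics.card_partialIndex n (⟨0, hk⟩ : Fin k))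
    push_cast at h ⊢
    constructor <;> linear_combination h
  · have hY : SymplecticQuadrics.Y K r (2 * r) hr (by omega) = SymplecticQuadrics.X K r hr := by
      unfold SymplecticQuadrics.Y SymplecticQuadrics.X
      simp only [SymplecticQuadrics.partialId_two_mul]
    rw [hY]
    exact hX.2
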